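/- \textbf{Theorem (corrected trapezoidal rule for $-\log|x|$).} Let $K\ge 0$ be an integer. The linear system $$\sum_{j=0}^{K} w_j\, j^{2k} = -\zeta'(-2k),\qquad k=0,1,\dots,K \qquad (0^0:=1),$$ where $\zeta$ is the Riemann zeta function, has exactly one real solution $w_0,\dots,w_K$. Let $a>0$, let $p>2K+1$ be an integer, and let $\eta:\mathbb{R}\to\mathbb{R}$ be a $C^p$ function supported in $[-a,a]$ with $$\eta(0)=1,\qquad \eta^{(k)}(0)=0,\quad k=1,\dots,2K+1.$$ Let $\tau$ be a real- or complex-valued function that is $C^\infty$ on $[-a,a]$, and let $s(x)=-\log|x|$. For a function $g$ put $$I[g]=\int_{-a}^{a} g(x)\,dx,\qquad T_h^0[g]=\sum_{\substack{-M\le n\le M\\ n\neq 0}} g(nh)\,h,\qquad h=\frac{a}{M+\frac12},\quad M=1,2,\dots$$ Then $s\,\tau\,\eta$ is integrable on $[-a,a]$ and, as $M\to\infty$ (that is, as $h\to0^+$ along these grid spacings), $$I[s\,\tau\,\eta]=T_h^0[s\,\tau\,\eta]-\tau(0)\,h\log h+h\sum_{j=0}^{K}w_j\bigl(\tau(jh)+\tau(-jh)\bigr)+O\bigl(h^{2K+2}\bigr).$$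 -/

import Mathlib

open Set Filter MeasureTheory Asymptotics
open scoped ContDiff

namespace CorrectedTrapezoidal

/-- The integral `I[g]` of `g` over `[-a, a]`. -/
noncomputable def I {𝕜 : Type*} [RCLike 𝕜] (a : ℝ) (g : ℝ → 𝕜) : 𝕜 :=
  ∫ x in (-a)..a, g x

/-- The grid spacing `h = a / (M + 1/2)`. -/
noncomputable def spacing (a : ℝ) (M : ℕ) : ℝ := a / ((M : ℝ) + 1 / 2)

/-- The punctured trapezoidal rule: the sum of `g (n h) h` over `-M ≤ n ≤ M`, `n ≠ 0`, with
`h = a / (M + 1/2)`. -/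
noncomputable def puncturedTrapezoidal {𝕜 : Type*} [RCLike 𝕜] (a : ℝ) (M : ℕ) (g : ℝ → 𝕜) : 𝕜 :=
  ∑ n ∈ (Finset.Icc (-(M : ℤ)) (M : ℤ)).erase 0,
    g ((n : ℝ) * spacing a M) * ((spacing a M : ℝ) : 𝕜)

/-- The singular function `s(x) = -log |x|`. -/
noncomputable def negLogAbs (x : ℝ) : ℝ := -Real.log |x|

/-- The linear system `∑_{j=0}^K w_j j^{2k} = -ζ'(-2k)`, `k = 0, …, K` (with `0 ^ 0 = 1`). -/
def IsZetaPrimeWeights (K : ℕ) (w : Fin (K + 1) → ℝ) : Prop :=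
  ∀ k : ℕ, k ≤ K →
    ((∑ j : Fin (K + 1), w j * ((j : ℕ) : ℝ) ^ (2 * k) : ℝ) : ℂ) =
      -deriv riemannZeta (-(2 * (k : ℂ)))

/-- Cutoffs: `η ∈ C^p_c([-a, a])` with `η(0) = 1` and `η^{(k)}(0) = 0` for `1 ≤ k ≤ m`. -/
structure IsCutoff (a : ℝ) (p m : ℕ) (η : ℝ → ℝ) : Prop where
  contDiff : ContDiff ℝ p η
  tsupport_subset : tsupport η ⊆ Icc (-a) a
  map_zero : η 0 = 1
  iteratedDeriv_zero : ∀ k : ℕ, 1 ≤ k → k ≤ m → iteratedDeriv k η 0 = 0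

end CorrectedTrapezoidal

/-!
Symmetrizing the integrand `F = η τ` reduces the claim to an even function `f` on `[0, a]` weighted
by `log x`, which is the derivative of `x ^ u` at `u = 0`. For complex `u` near `0` the sum of
`h (n h) ^ u f (n h)` over `n ≥ 1` differs from `∫ x ^ u f` by the endpoint terms
`h ^ (u + i + 1) ζ(-u - i) f⁽ⁱ⁾(0) / i!` up to `O(h ^ (2 K + 2))`, locally uniformly in `u`: this is
the Euler–Maclaurin formula for `x ^ (u + i)`, whose constant term is `ζ(-u - i)`. The difference
is holomorphic in `u`, so Cauchy's estimate carries the bound over to its derivative at `u = 0`.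

That derivative contains `h ^ (i + 1) (ζ(-i) log h - ζ'(-i)) f⁽ⁱ⁾(0) / i!`. The odd terms vanish
since `f` is even; among the even ones `ζ(0) = -1/2` gives the `h log h` correction and
`ζ(-2) = ζ(-4) = ⋯ = 0` removes every other logarithm. What remains is matched by the weights, whose
linear system is a Vandermonde system in the nodes `j ^ 2`, and `η` agrees with `1` near `0` to the
order that allows `τ` to be sampled in place of `η τ`.
-/

namespace CorrectedTrapezoidal

section IteratedDeriv

variable {F : Type*} [NormedAddCommGroup F] [NormedSpace ℝ F] {f : ℝ → F} {n : ℕ} {x : ℝ}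

theorem hasDerivAt_iteratedDeriv (hf : ContDiffAt ℝ n f x) {j : ℕ} (hj : j < n) :
    HasDerivAt (iteratedDeriv j f) (iteratedDeriv (j + 1) f x) x := by
  rw [iteratedDeriv_succ, hasDerivAt_deriv_iff, iteratedDeriv_eq_equiv_comp]
  exact (LinearIsometryEquiv.differentiable _).differentiableAt.comp x
    (hf.differentiableAt_iteratedFDeriv (by exact_mod_cast hj))

theorem continuousAt_iteratedDeriv (hf : ContDiffAt ℝ n f x) {j : ℕ} (hj : j ≤ n) :
    ContinuousAt (iteratedDeriv j f) x := by
  rw [iteratedDeriv_eq_equiv_comp]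
  exact (LinearIsometryEquiv.continuous _).continuousAt.comp
    (hf.continuousAt_iteratedFDeriv (by exact_mod_cast hj))

end IteratedDeriv

/-- The one-periodic extension of the Bernoulli polynomial `B_k`, divided by `k!`; it agrees with
`B_k / k!` on `[0, 1)`. -/
noncomputable def periodicBernoulli (k : ℕ) (x : ℝ) : ℝ :=
  bernoulliFun k (Int.fract x) / k.factorial

theorem periodicBernoulli_one (x : ℝ) : periodicBernoulli 1 x = Int.fract x - 1 / 2 := by
  simp [periodicBernoulli]

theorem measurable_periodicBernoulli (k : ℕ) : Measurable (periodicBernoulli k) :=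
  ((continuous_bernoulliFun k).measurable.comp measurable_fract).div_const _

theorem continuous_periodicBernoulli {k : ℕ} (hk : k ≠ 1) : Continuous (periodicBernoulli k) :=
  (ContinuousOn.comp_fract'' (continuous_bernoulliFun k).continuousOn
    (bernoulliFun_endpoints_eq_of_ne_one hk).symm).div_const _

theorem exists_abs_periodicBernoulli_le (k : ℕ) :
    ∃ C : ℝ, 0 < C ∧ ∀ x, |periodicBernoulli k x| ≤ C := by
  obtain ⟨C, hC⟩ := (isCompact_Icc (a := (0 : ℝ)) (b := 1)).exists_bound_of_continuousOn
    ((continuous_bernoulliFun k).div_const (k.factorial : ℝ)).continuousOn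
  exact ⟨max C 1, by positivity, fun x => le_max_of_le_left <|
    hC _ ⟨Int.fract_nonneg x, (Int.fract_lt_one x).le⟩⟩

theorem hasDerivWithinAt_periodicBernoulli (k : ℕ) (x : ℝ) :
    HasDerivWithinAt (periodicBernoulli (k + 1)) (periodicBernoulli k x) (Ioi x) x := by
  have hderiv : HasDerivAt (fun y : ℝ => bernoulliFun (k + 1) (y - ⌊x⌋) / (k + 1).factorial)
      (periodicBernoulli k x) x := by
    refine (((hasDerivAt_bernoulliFun (k + 1) (x - ⌊x⌋)).comp x
      ((hasDerivAt_id x).sub_const (⌊x⌋ : ℝ))).div_const _).congr_deriv ?_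
    rw [periodicBernoulli, Int.fract, Nat.factorial_succ]
    push_cast
    field_simp
  refine hderiv.hasDerivWithinAt.congr_of_eventuallyEq ?_ rfl
  filter_upwards [Ioo_mem_nhdsGT (Int.lt_floor_add_one x)] with y hy
  rw [periodicBernoulli, Int.fract, Int.floor_eq_iff.2 ⟨(Int.floor_le x).trans hy.1.le, hy.2⟩]

section EulerMaclaurin

variable {𝕜 : Type*} [RCLike 𝕜]

theorem intervalIntegrable_periodicBernoulli_smul (k : ℕ) {g : ℝ → 𝕜} {A B : ℝ}
    (hg : IntervalIntegrable g volume A B) :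
    IntervalIntegrable (fun x => periodicBernoulli k x • g x) volume A B := by
  obtain ⟨C, -, hC⟩ := exists_abs_periodicBernoulli_le k
  rw [intervalIntegrable_iff] at hg ⊢
  exact hg.bdd_smul C (measurable_periodicBernoulli k).aestronglyMeasurable (ae_of_all _ hC)

theorem sum_Ioc_eq_integral_add_integral_periodicBernoulli_one {g : ℝ → 𝕜} {A B : ℝ}
    (hA : 0 ≤ A) (hAB : A ≤ B) (hg : ∀ x ∈ Icc A B, ContDiffAt ℝ 1 g x) :
    ∑ n ∈ Finset.Ioc ⌊A⌋₊ ⌊B⌋₊, g n = (∫ x in A..B, g x) -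
      (periodicBernoulli 1 B • g B - periodicBernoulli 1 A • g A) +
      ∫ x in A..B, periodicBernoulli 1 x • deriv g x := by
  have hdiff : ∀ x ∈ Icc A B, DifferentiableAt ℝ g x := fun x hx =>
    (hg x hx).differentiableAt one_ne_zero
  have hcont : ContinuousOn (deriv g) (Icc A B) := fun x hx => by
    simpa only [iteratedDeriv_one] using
      (continuousAt_iteratedDeriv (n := 1) (hg x hx) le_rfl).continuousWithinAt
  have hint : IntervalIntegrable (deriv g) volume A B := hcont.intervalIntegrable_of_Icc hAB
  have habel := sum_mul_eq_sub_sub_integral_mul (fun _ => (1 : 𝕜)) hA hAB hdiff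
    hcont.integrableOn_Icc
  have hparts := intervalIntegral.integral_smul_deriv_eq_deriv_smul
    (u := fun x : ℝ => x + 1 / 2) (u' := fun _ => 1) (v := g) (v' := deriv g) (a := A) (b := B)
    (fun x _ => (hasDerivAt_id x).add_const _)
    (fun x hx => (hdiff x (by rwa [uIcc_of_le hAB] at hx)).hasDerivAt) (by simp) hint
  have hfloor : ∀ x : ℝ, 0 ≤ x →
      (⌊x⌋₊ : 𝕜) + 1 = ((x + 1 / 2 : ℝ) : 𝕜) - (periodicBernoulli 1 x : 𝕜) := fun x hx => by
    rw [periodicBernoulli_one, Int.fract, ← natCast_floor_eq_intCast_floor hx]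
    push_cast
    ring
  have hsplit : ∫ x in A..B, deriv g x * ((⌊x⌋₊ : 𝕜) + 1) =
      (∫ x in A..B, (x + 1 / 2) • deriv g x) - ∫ x in A..B, periodicBernoulli 1 x • deriv g x := by
    rw [← intervalIntegral.integral_sub (hint.continuousOn_smul (by fun_prop))
      (intervalIntegrable_periodicBernoulli_smul 1 hint)]
    refine intervalIntegral.integral_congr fun x hx => ?_
    rw [uIcc_of_le hAB] at hx
    simp only [hfloor x (hA.trans hx.1), RCLike.real_smul_eq_coe_mul]
    ring
  simp only [mul_one, Finset.sum_const, Nat.card_Icc, tsub_zero, nsmul_eq_mul, Nat.cast_add,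
    Nat.cast_one] at habel
  rw [habel, ← intervalIntegral.integral_of_le hAB, hsplit, hparts, hfloor A hA,
    hfloor B (hA.trans hAB)]
  simp only [one_smul, RCLike.real_smul_eq_coe_mul]
  ring

/-- The boundary terms `∑_{j < m} (-1)^{j+1} B_{j+1}({x}) / (j+1)! g^{(j)}(x)` of the
Euler-Maclaurin formula of order `m`. -/
noncomputable def eulerMaclaurinBoundary (m : ℕ) (g : ℝ → 𝕜) (x : ℝ) : 𝕜 :=
  ∑ j ∈ Finset.range m, (-1 : ℝ) ^ (j + 1) • periodicBernoulli (j + 1) x • iteratedDeriv j g x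

theorem sum_Ioc_eq_integral_add_eulerMaclaurinBoundary (m : ℕ) {g : ℝ → 𝕜} {A B : ℝ}
    (hA : 0 ≤ A) (hAB : A ≤ B) (hg : ∀ x ∈ Icc A B, ContDiffAt ℝ (m + 1 : ℕ) g x) :
    ∑ n ∈ Finset.Ioc ⌊A⌋₊ ⌊B⌋₊, g n = (∫ x in A..B, g x) +
      (eulerMaclaurinBoundary (m + 1) g B - eulerMaclaurinBoundary (m + 1) g A) +
      (-1 : ℝ) ^ m • ∫ x in A..B, periodicBernoulli (m + 1) x • iteratedDeriv (m + 1) g x := by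
  induction m with
  | zero =>
    rw [sum_Ioc_eq_integral_add_integral_periodicBernoulli_one hA hAB (by simpa using hg)]
    simp only [eulerMaclaurinBoundary, zero_add, Finset.range_one, Finset.sum_singleton, pow_one,
      pow_zero, iteratedDeriv_zero, iteratedDeriv_one, neg_smul, one_smul]
    ring
  | succ m ih =>
    have hder : ∀ x ∈ Icc A B, HasDerivAt (iteratedDeriv (m + 1) g) (iteratedDeriv (m + 2) g x) x :=
      fun x hx => hasDerivAt_iteratedDeriv (hg x hx) (by lia)
    have hint : IntervalIntegrable (iteratedDeriv (m + 2) g) volume A B :=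
      ContinuousOn.intervalIntegrable_of_Icc hAB fun x hx =>
        (continuousAt_iteratedDeriv (hg x hx) le_rfl).continuousWithinAt
    have hparts := intervalIntegral.integral_smul_deriv_eq_deriv_smul_of_hasDeriv_right
      (u := periodicBernoulli (m + 2)) (u' := periodicBernoulli (m + 1))
      (v := iteratedDeriv (m + 1) g) (v' := iteratedDeriv (m + 2) g) (a := A) (b := B)
      (continuous_periodicBernoulli (by lia)).continuousOn
      (fun x hx => (hder x (by rwa [uIcc_of_le hAB] at hx)).continuousAt.continuousWithinAt)
      (fun x _ => hasDerivWithinAt_periodicBernoulli (m + 1) x)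
      (fun x hx => (hder x (Ioo_subset_Icc_self (by simpa [hAB] using hx))).hasDerivWithinAt)
      (by
        simpa using intervalIntegrable_periodicBernoulli_smul (m + 1)
          (intervalIntegrable_const (c := (1 : ℝ)))) hint
    rw [ih fun x hx => (hg x hx).of_le (by exact_mod_cast Nat.le_succ _), hparts]
    simp only [eulerMaclaurinBoundary, Finset.sum_range_succ _ (m + 1), pow_succ]
    module

end EulerMaclaurin

section Defect

variable {𝕜 : Type*} [RCLike 𝕜] {g : ℝ → 𝕜} {m : ℕ} {X : ℝ}

theorem tendsto_eulerMaclaurinBoundary_zero {l : Filter ℝ}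
    (hg : ∀ j < m, Tendsto (iteratedDeriv j g) l (nhds 0)) :
    Tendsto (eulerMaclaurinBoundary m g) l (nhds 0) := by
  rw [← Finset.sum_const_zero (s := Finset.range m)]
  refine tendsto_finsetSum _ fun j hj => ?_
  obtain ⟨C, -, hC⟩ := exists_abs_periodicBernoulli_le (j + 1)
  refine squeeze_zero_norm (a := fun x => C * ‖iteratedDeriv j g x‖) (fun x => ?_) ?_
  · simp only [norm_smul, norm_pow, norm_neg, norm_one, one_pow, one_mul, Real.norm_eq_abs]
    gcongr
    exact hC x
  · simpa using (hg j (Finset.mem_range.1 hj)).norm.const_mul C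

/-- The error committed when the sum of `g` over the positive integers up to `X` is computed from
the Euler-Maclaurin formula on `[0, X]` as though there were no contribution from the endpoint `0`.
It is linear in `g`, and for `g x = x ^ s` it is essentially `ζ (-s)`. -/
noncomputable def eulerMaclaurinDefect (n : ℕ) (X : ℝ) (g : ℝ → 𝕜) : 𝕜 :=
  ∑ k ∈ Finset.Ioc 0 ⌊X⌋₊, g k - (∫ x in (0)..X, g x) - eulerMaclaurinBoundary n g X

theorem eulerMaclaurinDefect_eq {ε : ℝ} (hε : 0 < ε) (hε1 : ε < 1) (hεX : ε ≤ X)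
    (hg : ∀ x ∈ Ioc 0 X, ContDiffAt ℝ (m + 1 : ℕ) g x) (hint : IntervalIntegrable g volume 0 X) :
    eulerMaclaurinDefect (m + 1) X g =
      (-1 : ℝ) ^ m • (∫ x in ε..X, periodicBernoulli (m + 1) x • iteratedDeriv (m + 1) g x) -
        eulerMaclaurinBoundary (m + 1) g ε - ∫ x in (0)..ε, g x := by
  have hEM := sum_Ioc_eq_integral_add_eulerMaclaurinBoundary m hε.le hεX
    fun x hx => hg x ⟨hε.trans_le hx.1, hx.2⟩
  have hadj := intervalIntegral.integral_add_adjacent_intervals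
    (hint.mono_set (uIcc_subset_uIcc_left (mem_uIcc_of_le hε.le hεX)))
    (hint.mono_set (uIcc_subset_uIcc_right (mem_uIcc_of_le hε.le hεX)))
  rw [Nat.floor_eq_zero.2 hε1] at hEM
  rw [eulerMaclaurinDefect, hEM, ← hadj]
  ring

theorem tendsto_integral_nhdsGT_zero (hX : 0 < X) (hint : IntervalIntegrable g volume 0 X) :
    Tendsto (fun ε => ∫ x in (0)..ε, g x) (nhdsWithin 0 (Ioi 0)) (nhds 0) := by
  have hcont := intervalIntegral.continuousOn_primitive_interval' hint left_mem_uIcc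
    0 left_mem_uIcc
  rw [ContinuousWithinAt, intervalIntegral.integral_same, uIcc_of_le hX.le] at hcont
  exact hcont.mono_left (nhdsWithin_le_of_mem (Icc_mem_nhdsGT hX))

theorem norm_eulerMaclaurinDefect_le {B : ℝ} {φ : ℝ → ℝ} (hX : 0 < X)
    (hB : ∀ x, |periodicBernoulli (m + 1) x| ≤ B)
    (hg : ∀ x ∈ Ioc 0 X, ContDiffAt ℝ (m + 1 : ℕ) g x) (hint : IntervalIntegrable g volume 0 X)
    (hzero : ∀ j ≤ m, Tendsto (iteratedDeriv j g) (nhdsWithin 0 (Ioi 0)) (nhds 0))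
    (hφ : IntervalIntegrable φ volume 0 X)
    (hgφ : ∀ x ∈ Ioc 0 X, ‖iteratedDeriv (m + 1) g x‖ ≤ φ x) :
    ‖eulerMaclaurinDefect (m + 1) X g‖ ≤ B * ∫ x in (0)..X, φ x := by
  have hφ0 : ∀ x ∈ Ioc 0 X, 0 ≤ φ x := fun x hx => (norm_nonneg _).trans (hgφ x hx)
  have hB0 : 0 ≤ B := (abs_nonneg _).trans (hB 0)
  have hlim : Tendsto (fun ε => ‖eulerMaclaurinDefect (m + 1) X g +
      (eulerMaclaurinBoundary (m + 1) g ε + ∫ x in (0)..ε, g x)‖) (nhdsWithin 0 (Ioi 0))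
      (nhds ‖eulerMaclaurinDefect (m + 1) X g‖) := by
    simpa using (tendsto_const_nhds.add ((tendsto_eulerMaclaurinBoundary_zero
      fun j hj => hzero j (by lia)).add (tendsto_integral_nhdsGT_zero hX hint))).norm
  refine le_of_tendsto hlim ?_
  filter_upwards [Ioo_mem_nhdsGT (lt_min one_pos hX)] with ε ⟨hε, hεX⟩
  have hεX' := (hεX.trans_le (min_le_right _ _)).le
  rw [eulerMaclaurinDefect_eq hε (hεX.trans_le (min_le_left _ _)) hεX' hg hint]
  have hsub : ∫ x in ε..X, φ x ≤ ∫ x in (0)..X, φ x :=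
    intervalIntegral.integral_mono_interval hε.le hεX' le_rfl
      ((ae_restrict_iff' measurableSet_Ioc).2 (ae_of_all _ hφ0)) hφ
  calc _ = ‖∫ x in ε..X, periodicBernoulli (m + 1) x • iteratedDeriv (m + 1) g x‖ := by
        simp [norm_smul]
    _ ≤ ∫ x in ε..X, B * φ x := by
        refine intervalIntegral.norm_integral_le_of_norm_le hεX' (ae_of_all _ fun x hx => ?_)
          ((hφ.mono_set (uIcc_subset_uIcc_right (mem_uIcc_of_le hε.le hεX'))).const_mul B)
        rw [norm_smul]
        exact mul_le_mul (hB x) (hgφ x ⟨hε.trans hx.1, hx.2⟩) (norm_nonneg _) hB0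
    _ ≤ B * ∫ x in (0)..X, φ x := by
        rw [intervalIntegral.integral_const_mul]
        gcongr

end Defect

section Powers

theorem contDiffAt_ofReal_cpow (s : ℂ) {n : WithTop ℕ∞} {x : ℝ} (hx : 0 < x) :
    ContDiffAt ℝ n (fun t : ℝ => (t : ℂ) ^ s) x := by
  have hcpow : ContDiffAt ℂ n (fun z : ℂ => z ^ s) x :=
    (analyticAt_id.cpow analyticAt_const (Complex.ofReal_mem_slitPlane.2 hx)).contDiffAt
  exact (hcpow.restrict_scalars ℝ).comp x Complex.ofRealCLM.contDiff.contDiffAt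

theorem iteratedDeriv_ofReal_cpow (s : ℂ) (j : ℕ) {x : ℝ} (hx : 0 < x) :
    iteratedDeriv j (fun t : ℝ => (t : ℂ) ^ s) x =
      (descPochhammer ℂ j).eval s * (x : ℂ) ^ (s - j) := by
  induction j generalizing x with
  | zero => simp
  | succ j ih =>
    have heq : iteratedDeriv j (fun t : ℝ => (t : ℂ) ^ s) =ᶠ[nhds x]
        fun t => (descPochhammer ℂ j).eval s * (t : ℂ) ^ (s - j) :=
      (eventually_gt_nhds hx).mono fun t ht => ih ht
    have hderiv : HasDerivAt (fun z : ℂ => z ^ (s - j)) ((s - j) * (x : ℂ) ^ (s - j - 1) * 1) x :=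
      (hasDerivAt_id (x : ℂ)).cpow_const (Complex.ofReal_mem_slitPlane.2 hx)
    rw [iteratedDeriv_succ, heq.deriv_eq, (hderiv.comp_ofReal.const_mul _).deriv,
      descPochhammer_succ_eval, Nat.cast_succ, sub_sub]
    ring

theorem norm_iteratedDeriv_ofReal_cpow (s : ℂ) (j : ℕ) {x : ℝ} (hx : 0 < x) :
    ‖iteratedDeriv j (fun t : ℝ => (t : ℂ) ^ s) x‖ =
      ‖(descPochhammer ℂ j).eval s‖ * x ^ (s.re - j) := by
  rw [iteratedDeriv_ofReal_cpow s j hx, norm_mul, Complex.norm_cpow_eq_rpow_re_of_pos hx]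
  simp

end Powers

section Zeta

/-- The tail integral of the Euler-Maclaurin formula of order `n` for `x ^ s`. -/
noncomputable def cpowTail (n : ℕ) (X : ℝ) (s : ℂ) : ℂ :=
  ∫ x in Ioi X, (periodicBernoulli n x : ℂ) * (x : ℂ) ^ (s - n)

theorem integrableOn_periodicBernoulli_mul_cpow (n : ℕ) {s : ℂ} (hs : s.re < -1) {X : ℝ}
    (hX : 0 < X) :
    IntegrableOn (fun x : ℝ => (periodicBernoulli n x : ℂ) * (x : ℂ) ^ s) (Ioi X) := by
  obtain ⟨C, -, hC⟩ := exists_abs_periodicBernoulli_le n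
  exact (integrableOn_Ioi_cpow_of_lt hs hX).bdd_mul (c := C)
    (Complex.measurable_ofReal.comp (measurable_periodicBernoulli n)).aestronglyMeasurable
    (ae_of_all _ fun x => by simpa using hC x)

theorem norm_cpowTail_le {n : ℕ} {B : ℝ} (hB : ∀ x, |periodicBernoulli n x| ≤ B) {s : ℂ}
    (hs : s.re < n - 1) {X : ℝ} (hX : 0 < X) :
    ‖cpowTail n X s‖ ≤ B * (X ^ (s.re - n + 1) / (n - 1 - s.re)) := by
  have hexp : s.re - n < -1 := by linarith
  calc ‖cpowTail n X s‖ ≤ ∫ x in Ioi X, B * x ^ (s.re - n) := by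
        refine norm_integral_le_of_norm_le ((integrableOn_Ioi_rpow_of_lt hexp hX).const_mul B) ?_
        filter_upwards [ae_restrict_mem measurableSet_Ioi] with x hx
        rw [norm_mul, Complex.norm_cpow_eq_rpow_re_of_pos (hX.trans hx)]
        simp only [Complex.norm_real, Real.norm_eq_abs, Complex.sub_re, Complex.natCast_re]
        have := (hX.trans hx).le
        gcongr
        exact hB x
    _ = B * (X ^ (s.re - n + 1) / (n - 1 - s.re)) := by
        rw [integral_const_mul, integral_Ioi_rpow_of_lt hexp hX, neg_div, ← div_neg]
        congr 3
        ring

theorem cpowTail_eq_mellin (n : ℕ) {X : ℝ} (hX : 0 < X) (s : ℂ) :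
    cpowTail n X s =
      mellin ((Ioi X).indicator fun x => (periodicBernoulli n x : ℂ)) (s - n + 1) := by
  have hind : ∀ t : ℝ, (t : ℂ) ^ (s - n + 1 - 1) •
      (Ioi X).indicator (fun x => (periodicBernoulli n x : ℂ)) t =
      (Ioi X).indicator (fun x : ℝ => (periodicBernoulli n x : ℂ) * (x : ℂ) ^ (s - n)) t := by
    intro t
    by_cases ht : t ∈ Ioi X <;> simp [ht, mul_comm]
  simp_rw [mellin, hind]
  rw [setIntegral_indicator measurableSet_Ioi, Ioi_inter_Ioi, max_eq_right hX.le, cpowTail]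

theorem differentiableAt_cpowTail (n : ℕ) {X : ℝ} (hX : 0 < X) {s : ℂ} (hs : s.re < n - 1) :
    DifferentiableAt ℂ (cpowTail n X) s := by
  obtain ⟨C, hC0, hC⟩ := exists_abs_periodicBernoulli_le n
  set P : ℝ → ℂ := (Ioi X).indicator fun x => (periodicBernoulli n x : ℂ) with hP
  have hbound : ∀ x, ‖P x‖ ≤ C := fun x => by
    by_cases hx : x ∈ Ioi X
    · simpa [hP, hx] using hC x
    · simpa [hP, hx] using hC0.le
  have hmeas : Measurable P :=
    (Complex.measurable_ofReal.comp (measurable_periodicBernoulli n)).indicator measurableSet_Ioi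
  have hmellin : DifferentiableAt ℂ (mellin P) (s - n + 1) := by
    refine mellin_differentiableAt_of_isBigO_rpow (a := 0) (b := (s - n + 1).re - 1)
      (LocallyIntegrable.locallyIntegrableOn ?_ _)
      (IsBigO.of_bound C (Eventually.of_forall fun x => by simpa using hbound x))
      (by simp only [Complex.add_re, Complex.sub_re, Complex.natCast_re, Complex.one_re]; linarith)
      (IsBigO.of_bound 0 ?_) (by linarith)
    · exact (locallyIntegrable_const C).mono hmeas.aestronglyMeasurable
        (ae_of_all _ fun x => (hbound x).trans (le_abs_self C))
    · filter_upwards [Ioo_mem_nhdsGT hX] with x hx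
      simp [hP, hx.2.le]
  rw [show cpowTail n X = fun s => mellin P (s - n + 1) from funext (cpowTail_eq_mellin n hX)]
  exact DifferentiableAt.comp (f := fun s : ℂ => s - n + 1) s hmellin (by fun_prop)

/-- What remains of the Euler-Maclaurin formula of order `m + 1` for the sum of `x ^ s` over
`0 < x ≤ X` when its integral is left out; it is holomorphic in `s` for `re s < m`. -/
noncomputable def cpowSumRemainder (m : ℕ) (X : ℝ) (s : ℂ) : ℂ :=
  ∑ n ∈ Finset.Ioc 0 ⌊X⌋₊, (n : ℂ) ^ s -
    eulerMaclaurinBoundary (m + 1) (fun x : ℝ => (x : ℂ) ^ s) X +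
    (-1) ^ m * ((descPochhammer ℂ (m + 1)).eval s * cpowTail (m + 1) X s)

theorem tendsto_sum_Ioc_cpow {s : ℂ} (hs : s.re < -1) :
    Tendsto (fun Y : ℝ => ∑ n ∈ Finset.Ioc 0 ⌊Y⌋₊, (n : ℂ) ^ s) atTop
      (nhds (riemannZeta (-s))) := by
  have hs' : 1 < (-s).re := by rw [Complex.neg_re]; linarith
  have hs0 : s ≠ 0 := by rintro rfl; norm_num at hs
  have hrange : ∀ N : ℕ, ∑ n ∈ Finset.range (N + 1), 1 / (n : ℂ) ^ (-s) =
      ∑ n ∈ Finset.Ioc 0 N, (n : ℂ) ^ s := fun N => by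
    rw [Finset.range_eq_Ico, Finset.sum_eq_sum_Ico_succ_bot N.succ_pos]
    simp only [Complex.cpow_neg, Nat.cast_zero, Complex.zero_cpow hs0, inv_zero,
      div_zero, zero_add, one_div, inv_inv]
    rfl
  rw [zeta_eq_tsum_one_div_nat_cpow hs']
  simp_rw [← hrange]
  exact (Complex.summable_one_div_nat_cpow.2 hs').hasSum.tendsto_sum_nat.comp
    ((tendsto_add_atTop_nat 1).comp tendsto_nat_floor_atTop)

theorem tendsto_eulerMaclaurinBoundary_cpow (m : ℕ) {s : ℂ} (hs : s.re < 0) :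
    Tendsto (eulerMaclaurinBoundary m fun x : ℝ => (x : ℂ) ^ s) atTop (nhds 0) := by
  refine tendsto_eulerMaclaurinBoundary_zero fun j _ => tendsto_zero_iff_norm_tendsto_zero.2 ?_
  have hrpow : Tendsto (fun x : ℝ => x ^ (-(j - s.re))) atTop (nhds 0) :=
    tendsto_rpow_neg_atTop (by linarith [(j.cast_nonneg : (0 : ℝ) ≤ j)])
  have hmul := hrpow.const_mul ‖(descPochhammer ℂ j).eval s‖
  rw [mul_zero] at hmul
  refine hmul.congr' ((eventually_gt_atTop 0).mono fun x hx => ?_)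
  rw [neg_sub]
  exact (norm_iteratedDeriv_ofReal_cpow s j hx).symm

theorem sum_Ioc_cpow_eq (m : ℕ) (s : ℂ) {X Y : ℝ} (hX : 0 < X) (hXY : X ≤ Y) :
    ∑ n ∈ Finset.Ioc ⌊X⌋₊ ⌊Y⌋₊, (n : ℂ) ^ s = (∫ x in X..Y, (x : ℂ) ^ s) +
      (eulerMaclaurinBoundary (m + 1) (fun x : ℝ => (x : ℂ) ^ s) Y -
        eulerMaclaurinBoundary (m + 1) (fun x : ℝ => (x : ℂ) ^ s) X) +
      (-1) ^ m * ((descPochhammer ℂ (m + 1)).eval s *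
        ∫ x in X..Y, (periodicBernoulli (m + 1) x : ℂ) * (x : ℂ) ^ (s - (m + 1 : ℕ))) := by
  have hEM := sum_Ioc_eq_integral_add_eulerMaclaurinBoundary m hX.le hXY
    fun x hx => contDiffAt_ofReal_cpow s (hX.trans_le hx.1)
  have hderiv : ∫ x in X..Y, periodicBernoulli (m + 1) x •
        iteratedDeriv (m + 1) (fun x : ℝ => (x : ℂ) ^ s) x =
      (descPochhammer ℂ (m + 1)).eval s *
        ∫ x in X..Y, (periodicBernoulli (m + 1) x : ℂ) * (x : ℂ) ^ (s - (m + 1 : ℕ)) := by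
    rw [← intervalIntegral.integral_const_mul]
    refine intervalIntegral.integral_congr fun x hx => ?_
    rw [uIcc_of_le hXY] at hx
    simp only [iteratedDeriv_ofReal_cpow s _ (hX.trans_le hx.1), Complex.real_smul]
    ring
  rw [hderiv, Complex.real_smul] at hEM
  simpa only [Complex.ofReal_natCast, Complex.ofReal_pow, Complex.ofReal_neg,
    Complex.ofReal_one] using hEM

theorem cpowSumRemainder_eq_of_re_lt (m : ℕ) {s : ℂ} (hs : s.re < -1) {X : ℝ} (hX : 0 < X) :
    cpowSumRemainder m X s = riemannZeta (-s) + (X : ℂ) ^ (s + 1) / (s + 1) := by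
  have hintegral := intervalIntegral_tendsto_integral_Ioi X (integrableOn_Ioi_cpow_of_lt hs hX)
    tendsto_id
  have htail := intervalIntegral_tendsto_integral_Ioi X
    (integrableOn_periodicBernoulli_mul_cpow (m + 1) (s := s - (m + 1 : ℕ))
      (by simp only [Complex.sub_re, Complex.natCast_re]; push_cast; linarith) hX) tendsto_id
  have hlim := ((hintegral.add ((tendsto_eulerMaclaurinBoundary_cpow (m + 1)
    (by linarith : s.re < 0)).sub_const
      (eulerMaclaurinBoundary (m + 1) (fun x : ℝ => (x : ℂ) ^ s) X))).add
    ((htail.const_mul ((descPochhammer ℂ (m + 1)).eval s)).const_mul ((-1) ^ m))).const_add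
      (∑ n ∈ Finset.Ioc 0 ⌊X⌋₊, (n : ℂ) ^ s)
  have hzeta := tendsto_nhds_unique_of_eventuallyEq (tendsto_sum_Ioc_cpow hs) hlim
    ((eventually_ge_atTop X).mono fun Y hY => by
      simp only [id]
      rw [← Finset.sum_Ioc_consecutive _ (Nat.zero_le _) (Nat.floor_le_floor hY),
        sum_Ioc_cpow_eq m s hX hY])
  rw [hzeta, integral_Ioi_cpow_of_lt hs hX, cpowSumRemainder, cpowTail]
  ring

theorem differentiableAt_sum_natCast_cpow (N : ℕ) (s : ℂ) :
    DifferentiableAt ℂ (fun s : ℂ => ∑ n ∈ Finset.Ioc 0 N, (n : ℂ) ^ s) s :=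
  DifferentiableAt.fun_sum fun n hn => differentiableAt_id.const_cpow
    (Or.inl (by exact_mod_cast (Finset.mem_Ioc.1 hn).1.ne'))

theorem differentiableAt_cpowSumRemainder (m : ℕ) {X : ℝ} (hX : 0 < X) {s : ℂ} (hs : s.re < m) :
    DifferentiableAt ℂ (cpowSumRemainder m X) s := by
  have hX0 : (X : ℂ) ≠ 0 := by exact_mod_cast hX.ne'
  have htail := differentiableAt_cpowTail (m + 1) hX (s := s) (by push_cast; linarith)
  have hboundary : DifferentiableAt ℂ (fun s : ℂ =>
      eulerMaclaurinBoundary (m + 1) (fun x : ℝ => (x : ℂ) ^ s) X) s := by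
    simp only [eulerMaclaurinBoundary, iteratedDeriv_ofReal_cpow _ _ hX]
    refine DifferentiableAt.fun_sum fun j _ => ((DifferentiableAt.mul
      (descPochhammer ℂ j).differentiableAt ?_).fun_const_smul _).fun_const_smul _
    exact (differentiableAt_id.sub_const _).const_cpow (Or.inl hX0)
  exact ((differentiableAt_sum_natCast_cpow _ s).sub hboundary).add
    (((descPochhammer ℂ (m + 1)).differentiableAt.mul htail).const_mul _)

theorem cpowSumRemainder_eq (m : ℕ) {s : ℂ} (hs : s.re < m) (hs1 : s ≠ -1) {X : ℝ} (hX : 0 < X) :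
    cpowSumRemainder m X s = riemannZeta (-s) + (X : ℂ) ^ (s + 1) / (s + 1) := by
  have hadd : ∀ z : ℂ, z ≠ -1 → z + 1 ≠ 0 := fun z hz h => hz (eq_neg_of_add_eq_zero_left h)
  have hzeta : ∀ z : ℂ, z ≠ -1 → (z + 1) * riemannZeta (-z) = -riemannZeta₁ (-z) := fun z hz => by
    rw [riemannZeta_eq_inv_sub_mul fun h => hz (by rw [← h, neg_neg]),
      show -z - 1 = -(z + 1) by ring, inv_neg, neg_mul, mul_neg, mul_inv_cancel_left₀ (hadd z hz)]
  have hopen : ∀ c : ℝ, IsOpen {z : ℂ | z.re < c} := fun c =>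
    isOpen_lt Complex.continuous_re continuous_const
  have hleft : AnalyticOnNhd ℂ (fun z => (z + 1) * cpowSumRemainder m X z) {z | z.re < m} :=
    DifferentiableOn.analyticOnNhd (fun z hz => (DifferentiableAt.mul (by fun_prop)
      (differentiableAt_cpowSumRemainder m hX hz)).differentiableWithinAt) (hopen m)
  have hright : AnalyticOnNhd ℂ (fun z => -riemannZeta₁ (-z) + (X : ℂ) ^ (z + 1)) {z | z.re < m} :=
    DifferentiableOn.analyticOnNhd (Differentiable.differentiableOn
      ((differentiable_riemannZeta₁.comp differentiable_neg).neg.add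
        ((differentiable_id.add_const _).const_cpow (Or.inl (by exact_mod_cast hX.ne'))))) (hopen m)
  have heq : (fun z => (z + 1) * cpowSumRemainder m X z) =ᶠ[nhds (-2)]
      fun z => -riemannZeta₁ (-z) + (X : ℂ) ^ (z + 1) := by
    filter_upwards [(hopen (-1)).mem_nhds (by simp : (-2 : ℂ).re < -1)] with z hz
    have hz1 : z ≠ -1 := by rintro rfl; simp at hz
    rw [cpowSumRemainder_eq_of_re_lt m hz hX, mul_add, hzeta z hz1, mul_div_cancel₀ _ (hadd z hz1)]
  have hkey := hleft.eqOn_of_preconnected_of_eventuallyEq hright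
    (convex_halfSpace_re_lt (m : ℝ)).isPreconnected (z₀ := -2)
    (by simpa using (neg_lt_zero.2 two_pos).trans_le m.cast_nonneg) heq hs
  refine mul_left_cancel₀ (hadd s hs1) (hkey.trans ?_)
  rw [mul_add, hzeta s hs1, mul_div_cancel₀ _ (hadd s hs1)]

theorem eulerMaclaurinDefect_cpow {m : ℕ} {s : ℂ} (hs : s.re < m) (hs1 : -1 < s.re) {X : ℝ}
    (hX : 0 < X) :
    eulerMaclaurinDefect (m + 1) X (fun x : ℝ => (x : ℂ) ^ s) = riemannZeta (-s) -
      (-1) ^ m * ((descPochhammer ℂ (m + 1)).eval s * cpowTail (m + 1) X s) := by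
  have hne : s + 1 ≠ 0 := fun h => by
    have := congrArg Complex.re h
    simp only [Complex.add_re, Complex.one_re, Complex.zero_re] at this
    linarith
  have hkey := cpowSumRemainder_eq m hs (fun h => hne (by rw [h, neg_add_cancel])) hX
  rw [cpowSumRemainder] at hkey
  rw [eulerMaclaurinDefect, integral_cpow (Or.inl hs1), Complex.ofReal_zero,
    Complex.zero_cpow hne, sub_zero]
  simp only [Complex.ofReal_natCast]
  linear_combination hkey

end Zeta

section Taylor

variable {E : Type*} [NormedAddCommGroup E] [NormedSpace ℝ E] {f : ℝ → E} {n : ℕ}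

theorem norm_iteratedDeriv_le_of_iteratedDeriv_eq_zero (hf : ContDiff ℝ n f) {c x A : ℝ}
    (hzero : ∀ i < n, iteratedDeriv i f c = 0)
    (hA : ∀ y ∈ uIcc c x, ‖iteratedDeriv n f y‖ ≤ A) {i : ℕ} (hi : i ≤ n) :
    ‖iteratedDeriv i f x‖ ≤ A * |x - c| ^ (n - i) := by
  induction hi using Nat.decreasingInduction generalizing x with
  | self => simpa using hA x right_mem_uIcc
  | of_succ i hi ih =>
    have hbound : ∀ y ∈ uIcc c x, ‖iteratedDeriv (i + 1) f y‖ ≤ A * |x - c| ^ (n - (i + 1)) := by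
      intro y hy
      have hA0 : 0 ≤ A := (norm_nonneg _).trans (hA c left_mem_uIcc)
      refine (ih fun z hz => hA z (uIcc_subset_uIcc_left hy hz)).trans ?_
      gcongr ?_ * ?_ ^ _
      exact abs_sub_left_of_mem_uIcc hy
    have hmvt := (convex_uIcc c x).norm_image_sub_le_of_norm_hasDerivWithin_le
      (fun y _ => (hasDerivAt_iteratedDeriv hf.contDiffAt hi).hasDerivWithinAt) hbound
      left_mem_uIcc right_mem_uIcc
    rwa [hzero i hi, sub_zero, mul_assoc, Real.norm_eq_abs, ← pow_succ,
      show n - (i + 1) + 1 = n - i by lia] at hmvt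

theorem isBigO_pow_of_iteratedDeriv_eq_zero (hf : ContDiff ℝ n f)
    (hzero : ∀ i < n, iteratedDeriv i f 0 = 0) : f =O[nhds 0] fun x => x ^ n := by
  have hcont : Continuous (iteratedDeriv n f) := hf.continuous_iteratedDeriv n le_rfl
  obtain ⟨A, hA⟩ := (isCompact_Icc (a := (-1 : ℝ)) (b := 1)).exists_bound_of_continuousOn
    hcont.continuousOn
  refine IsBigO.of_bound A ?_
  filter_upwards [Icc_mem_nhds (neg_lt_zero.2 one_pos) one_pos] with x hx
  simpa using norm_iteratedDeriv_le_of_iteratedDeriv_eq_zero hf hzero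
    (fun y hy => hA y (uIcc_subset_Icc (by simp) hx hy)) n.zero_le

theorem iteratedDeriv_eq_zero_of_eqOn_Ici {X x : ℝ} (hf : ContDiffAt ℝ n f x)
    (hX : EqOn f 0 (Ici X)) (hx : x ∈ Ici X) {i : ℕ} (hi : i ≤ n) :
    iteratedDeriv i f x = 0 := by
  rw [← iteratedDerivWithin_eq_iteratedDeriv (uniqueDiffOn_Ici X)
    (hf.of_le (by exact_mod_cast hi)) hx, iteratedDerivWithin_congr hX hx]
  simp

theorem iteratedDeriv_eq_zero_of_even (hf : Function.Even f) {i : ℕ} (hi : Odd i) :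
    iteratedDeriv i f 0 = 0 := by
  have hneg := iteratedDeriv_comp_neg i f 0
  simp only [hf _, hi.neg_one_pow, neg_zero, neg_smul, one_smul] at hneg
  have htwo : (2 : ℝ) • iteratedDeriv i f 0 = 0 := by
    rw [two_smul]
    exact eq_neg_iff_add_eq_zero.1 hneg
  exact (smul_eq_zero.1 htwo).resolve_left two_ne_zero

/-- The `i`-th Taylor coefficient of `f` at `0`. -/
noncomputable def taylorCoeff (f : ℝ → E) (i : ℕ) : E :=
  (i.factorial : ℝ)⁻¹ • iteratedDeriv i f 0

theorem norm_taylorCoeff_le (f : ℝ → E) (i : ℕ) : ‖taylorCoeff f i‖ ≤ ‖iteratedDeriv i f 0‖ := by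
  rw [taylorCoeff, norm_smul, norm_inv, Real.norm_natCast]
  exact mul_le_of_le_one_left (norm_nonneg _)
    (inv_le_one_of_one_le₀ (by exact_mod_cast i.factorial_pos))

/-- The difference between `f` and its Taylor polynomial at `0` with `n` terms. -/
noncomputable def taylorRemainder (n : ℕ) (f : ℝ → E) (x : ℝ) : E :=
  f x - ∑ i ∈ Finset.range n, x ^ i • taylorCoeff f i

theorem contDiff_taylorRemainder (hf : ContDiff ℝ n f) (k : ℕ) :
    ContDiff ℝ n (taylorRemainder k f) := by
  unfold taylorRemainder
  fun_prop

theorem iteratedDeriv_taylorRemainder {j : ℕ} (hf : ContDiff ℝ j f) (k : ℕ) (x : ℝ) :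
    iteratedDeriv j (taylorRemainder k f) x = iteratedDeriv j f x -
      ∑ i ∈ Finset.range k, ((i.descFactorial j : ℝ) * x ^ (i - j)) • taylorCoeff f i := by
  have hterm : ∀ i, ContDiff ℝ j (fun x : ℝ => x ^ i • taylorCoeff f i) := fun i => by fun_prop
  have hsub := iteratedDeriv_sub (n := j) (x := x) hf.contDiffAt
    (ContDiff.sum fun i (_ : i ∈ Finset.range k) => hterm i).contDiffAt
  refine hsub.trans ?_
  rw [iteratedDeriv_fun_sum fun i _ => (hterm i).contDiffAt]
  congr 1
  refine Finset.sum_congr rfl fun i _ => ?_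
  rw [iteratedDeriv_smul_const (by fun_prop), iteratedDeriv_pow]

theorem iteratedDeriv_taylorRemainder_of_le {j k : ℕ} (hkj : k ≤ j) (hf : ContDiff ℝ j f) (x : ℝ) :
    iteratedDeriv j (taylorRemainder k f) x = iteratedDeriv j f x := by
  rw [iteratedDeriv_taylorRemainder hf, Finset.sum_eq_zero, sub_zero]
  intro i hi
  rw [Nat.descFactorial_of_lt ((Finset.mem_range.1 hi).trans_le hkj), Nat.cast_zero, zero_mul,
    zero_smul]

theorem iteratedDeriv_taylorRemainder_zero {j k : ℕ} (hjk : j < k) (hf : ContDiff ℝ j f) :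
    iteratedDeriv j (taylorRemainder k f) 0 = 0 := by
  rw [iteratedDeriv_taylorRemainder hf, Finset.sum_eq_single_of_mem j (Finset.mem_range.2 hjk),
    Nat.descFactorial_self, Nat.sub_self, pow_zero, mul_one, taylorCoeff, smul_smul,
    mul_inv_cancel₀ (by positivity), one_smul, sub_self]
  intro i _ hij
  rcases hij.lt_or_gt with hlt | hgt
  · rw [Nat.descFactorial_of_lt hlt, Nat.cast_zero, zero_mul, zero_smul]
  · rw [zero_pow (by lia), mul_zero, zero_smul]

end Taylor

section Core

variable {u : ℂ} {m : ℕ} {X : ℝ}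

/-- The constant produced by the Leibniz rule when a function vanishing to high order at `0` is
multiplied by `x ^ u` and differentiated `j` times. -/
noncomputable def cpowLeibnizConst (j : ℕ) (u : ℂ) : ℝ :=
  ∑ i ∈ Finset.range (j + 1), (j.choose i : ℝ) * ‖(descPochhammer ℂ i).eval u‖

theorem continuous_cpowLeibnizConst (j : ℕ) : Continuous (cpowLeibnizConst j) :=
  continuous_finsetSum _ fun i _ => continuous_const.mul (descPochhammer ℂ i).continuous.norm

theorem norm_iteratedDeriv_cpow_mul_le {r : ℝ → ℂ} {j n : ℕ} (hjn : j ≤ n) {x A : ℝ} (hx : 0 < x)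
    (hr : ContDiffAt ℝ j r x) (hA : ∀ i ≤ j, ‖iteratedDeriv i r x‖ ≤ A * x ^ (n - i)) :
    ‖iteratedDeriv j (fun y : ℝ => (y : ℂ) ^ u * r y) x‖ ≤
      cpowLeibnizConst j u * A * x ^ (u.re + (n - j : ℕ)) := by
  have hleibniz := iteratedDeriv_mul (contDiffAt_ofReal_cpow u (n := (j : ℕ)) hx) hr
  refine (congrArg norm hleibniz).trans_le ?_
  rw [cpowLeibnizConst, Finset.sum_mul, Finset.sum_mul]
  refine norm_sum_le_of_le _ fun i hi => ?_
  have hij : i ≤ j := Nat.lt_succ_iff.1 (Finset.mem_range.1 hi)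
  rw [norm_mul, norm_mul, norm_iteratedDeriv_ofReal_cpow u i hx, Complex.norm_natCast]
  calc _ ≤ j.choose i * (‖(descPochhammer ℂ i).eval u‖ * x ^ (u.re - i)) *
        (A * x ^ (n - (j - i))) := by
        gcongr
        exact hA _ (Nat.sub_le j i)
    _ = _ := by
        rw [← Real.rpow_natCast x (n - (j - i)), show n - (j - i) = n - j + i by lia,
          show u.re + (n - j : ℕ) = u.re - i + (n - j + i : ℕ) by push_cast; ring,
          Real.rpow_add hx]
        ring

theorem tendsto_iteratedDeriv_cpow_mul_zero {r : ℝ → ℂ} {j n : ℕ} (hjn : j < n) (hu : -1 < u.re)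
    (hr : ContDiff ℝ n r) (hzero : ∀ i < n, iteratedDeriv i r 0 = 0) :
    Tendsto (iteratedDeriv j fun y : ℝ => (y : ℂ) ^ u * r y) (nhdsWithin 0 (Ioi 0)) (nhds 0) := by
  obtain ⟨A, hA⟩ := (isCompact_Icc (a := (0 : ℝ)) (b := 1)).exists_bound_of_continuousOn
    (hr.continuous_iteratedDeriv n le_rfl).continuousOn
  have hexp : 0 < u.re + (n - j : ℕ) := by
    have : (1 : ℝ) ≤ (n - j : ℕ) := by exact_mod_cast Nat.sub_pos_of_lt hjn
    linarith
  have hlim : Tendsto (fun x : ℝ => cpowLeibnizConst j u * A * x ^ (u.re + (n - j : ℕ)))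
      (nhdsWithin 0 (Ioi 0)) (nhds 0) := by
    have h0 := (Real.continuousAt_rpow_const 0 _ (Or.inr hexp.le)).tendsto.const_mul
      (cpowLeibnizConst j u * A)
    rw [Real.zero_rpow hexp.ne', mul_zero] at h0
    exact h0.mono_left nhdsWithin_le_nhds
  refine squeeze_zero_norm' ?_ hlim
  filter_upwards [Ioc_mem_nhdsGT one_pos] with x hx
  refine norm_iteratedDeriv_cpow_mul_le hjn.le hx.1
    (hr.of_le (by exact_mod_cast hjn.le)).contDiffAt fun i hi => ?_
  have hjet := norm_iteratedDeriv_le_of_iteratedDeriv_eq_zero hr hzero (x := x) (fun y hy => hA y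
    (uIcc_subset_Icc (left_mem_Icc.2 zero_le_one) (Ioc_subset_Icc_self hx) hy)) (hi.trans hjn.le)
  rwa [sub_zero, abs_of_pos hx.1] at hjet

theorem intervalIntegrable_cpow_mul {f : ℝ → ℂ} {a b : ℝ} (hu : -1 < u.re)
    (hf : ContinuousOn f (uIcc a b)) :
    IntervalIntegrable (fun x : ℝ => (x : ℂ) ^ u * f x) volume a b :=
  (intervalIntegral.intervalIntegrable_cpow' hu).mul_continuousOn hf

theorem norm_eulerMaclaurinDefect_cpow_mul_le {r : ℝ → ℂ} {A B : ℝ} (hX : 0 < X)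
    (hB : ∀ x, |periodicBernoulli (m + 1) x| ≤ B) (hu : -1 < u.re)
    (hr : ContDiff ℝ (m + 1 : ℕ) r) (hzero : ∀ i ≤ m, iteratedDeriv i r 0 = 0)
    (hA : ∀ x ∈ Icc 0 X, ‖iteratedDeriv (m + 1) r x‖ ≤ A) :
    ‖eulerMaclaurinDefect (m + 1) X fun x : ℝ => (x : ℂ) ^ u * r x‖ ≤
      B * cpowLeibnizConst (m + 1) u / (u.re + 1) * (A * X ^ (1 + u.re)) := by
  have hzero' : ∀ i < m + 1, iteratedDeriv i r 0 = 0 := fun i hi => hzero i (Nat.lt_succ_iff.1 hi)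
  have hbound := norm_eulerMaclaurinDefect_le
    (φ := fun x => cpowLeibnizConst (m + 1) u * A * x ^ u.re) hX hB
    (fun x hx => (contDiffAt_ofReal_cpow u hx.1).mul hr.contDiffAt)
    (intervalIntegrable_cpow_mul hu hr.continuous.continuousOn)
    (fun j hj => tendsto_iteratedDeriv_cpow_mul_zero (Nat.lt_succ_of_le hj) hu hr hzero')
    ((intervalIntegral.intervalIntegrable_rpow' hu).const_mul _) fun x hx => ?_
  · rw [intervalIntegral.integral_const_mul, integral_rpow (Or.inl hu),
      Real.zero_rpow (by linarith), sub_zero, add_comm u.re] at hbound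
    refine hbound.trans_eq ?_
    rw [add_comm u.re]
    ring
  · have hx0 : uIcc 0 x ⊆ Icc 0 X :=
      uIcc_subset_Icc (left_mem_Icc.2 hX.le) (Ioc_subset_Icc_self hx)
    have hleibniz := norm_iteratedDeriv_cpow_mul_le (u := u) le_rfl hx.1 hr.contDiffAt
      fun i hi => by
        simpa [abs_of_pos hx.1] using norm_iteratedDeriv_le_of_iteratedDeriv_eq_zero hr hzero'
          (fun y hy => hA y (hx0 hy)) hi
    simpa using hleibniz

theorem eulerMaclaurinDefect_sub {n : ℕ} {f g : ℝ → ℂ} (hf : ContDiffAt ℝ n f X)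
    (hg : ContDiffAt ℝ n g X) (hfint : IntervalIntegrable f volume 0 X)
    (hgint : IntervalIntegrable g volume 0 X) :
    eulerMaclaurinDefect n X (fun x => f x - g x) =
      eulerMaclaurinDefect n X f - eulerMaclaurinDefect n X g := by
  have hboundary : eulerMaclaurinBoundary n (fun x => f x - g x) X =
      eulerMaclaurinBoundary n f X - eulerMaclaurinBoundary n g X := by
    simp only [eulerMaclaurinBoundary, ← Finset.sum_sub_distrib, ← smul_sub]
    refine Finset.sum_congr rfl fun j hj => ?_
    have hjn : (j : WithTop ℕ∞) ≤ n := by exact_mod_cast (Finset.mem_range.1 hj).le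
    congr 2
    exact iteratedDeriv_sub (hf.of_le hjn) (hg.of_le hjn)
  rw [eulerMaclaurinDefect, hboundary, intervalIntegral.integral_sub hfint hgint,
    Finset.sum_sub_distrib, eulerMaclaurinDefect, eulerMaclaurinDefect]
  ring

theorem eulerMaclaurinDefect_sum_mul {n k : ℕ} {g : ℕ → ℝ → ℂ} {c : ℕ → ℂ}
    (hg : ∀ i < k, ContDiffAt ℝ n (g i) X)
    (hint : ∀ i < k, IntervalIntegrable (g i) volume 0 X) :
    eulerMaclaurinDefect n X (fun x => ∑ i ∈ Finset.range k, g i x * c i) =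
      ∑ i ∈ Finset.range k, eulerMaclaurinDefect n X (g i) * c i := by
  have hboundary : eulerMaclaurinBoundary n (fun x => ∑ i ∈ Finset.range k, g i x * c i) X =
      ∑ i ∈ Finset.range k, eulerMaclaurinBoundary n (g i) X * c i := by
    simp only [eulerMaclaurinBoundary, Finset.sum_mul]
    rw [Finset.sum_comm]
    refine Finset.sum_congr rfl fun j hj => ?_
    have hjn : (j : WithTop ℕ∞) ≤ n := by exact_mod_cast (Finset.mem_range.1 hj).le
    have hgj : ∀ i ∈ Finset.range k, ContDiffAt ℝ j (g i) X := fun i hi =>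
      (hg i (Finset.mem_range.1 hi)).of_le hjn
    rw [iteratedDeriv_fun_sum fun i hi => (hgj i hi).mul contDiffAt_const, Finset.smul_sum,
      Finset.smul_sum]
    refine Finset.sum_congr rfl fun i hi => ?_
    rw [smul_mul_assoc, smul_mul_assoc]
    congr 2
    exact iteratedDeriv_smul_const (hgj i hi) (c i)
  simp only [eulerMaclaurinDefect, hboundary, sub_mul, Finset.sum_sub_distrib, Finset.sum_mul]
  rw [Finset.sum_comm, intervalIntegral.integral_finsetSum fun i hi =>
    (hint i (Finset.mem_range.1 hi)).mul_const (c i)]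
  simp only [intervalIntegral.integral_mul_const]

theorem cpow_mul_taylorRemainder (hu : -1 < u.re) (F : ℝ → ℂ) (x : ℝ) :
    (x : ℂ) ^ u * taylorRemainder m F x =
      (x : ℂ) ^ u * F x - ∑ i ∈ Finset.range m, (x : ℂ) ^ (u + i) * taylorCoeff F i := by
  rw [taylorRemainder, mul_sub, Finset.mul_sum]
  congr 1
  refine Finset.sum_congr rfl fun i _ => ?_
  rw [Complex.real_smul, ← mul_assoc, Complex.ofReal_pow]
  congr 1
  rcases eq_or_ne x 0 with rfl | hx
  · rcases i.eq_zero_or_pos with rfl | hi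
    · simp
    · have hne : u + i ≠ 0 := fun h => by
        have hre := congrArg Complex.re h
        have : (1 : ℝ) ≤ i := by exact_mod_cast hi
        simp only [Complex.add_re, Complex.natCast_re, Complex.zero_re] at hre
        linarith
      rw [Complex.ofReal_zero, zero_pow hi.ne', mul_zero, Complex.zero_cpow hne]
  · rw [Complex.cpow_add _ _ (Complex.ofReal_ne_zero.2 hx), Complex.cpow_natCast]

theorem eulerMaclaurinDefect_cpow_mul_eq {n : ℕ} {F : ℝ → ℂ} (hu : -1 < u.re) (hX : 0 < X)
    (hF : ContDiff ℝ n F) :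
    eulerMaclaurinDefect n X (fun x : ℝ => (x : ℂ) ^ u * F x) =
      eulerMaclaurinDefect n X (fun x : ℝ => (x : ℂ) ^ u * taylorRemainder m F x) +
        ∑ i ∈ Finset.range m,
          eulerMaclaurinDefect n X (fun x : ℝ => (x : ℂ) ^ (u + i)) * taylorCoeff F i := by
  have hre : ∀ i : ℕ, -1 < (u + i).re := fun i => by
    have := i.cast_nonneg (α := ℝ)
    rw [Complex.add_re, Complex.natCast_re]
    linarith
  have hint : ∀ i : ℕ, IntervalIntegrable (fun x : ℝ => (x : ℂ) ^ (u + i)) volume 0 X :=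
    fun i => intervalIntegral.intervalIntegrable_cpow' (hre i)
  simp only [cpow_mul_taylorRemainder hu]
  rw [eulerMaclaurinDefect_sub, eulerMaclaurinDefect_sum_mul, sub_add_cancel]
  · exact fun i _ => contDiffAt_ofReal_cpow _ hX
  · exact fun i _ => hint i
  · exact (contDiffAt_ofReal_cpow u hX).mul hF.contDiffAt
  · exact ContDiffAt.sum fun i _ => (contDiffAt_ofReal_cpow _ hX).mul contDiffAt_const
  · exact intervalIntegrable_cpow_mul hu hF.continuous.continuousOn
  · simpa only [Finset.sum_fn] using IntervalIntegrable.sum (Finset.range m)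
      fun i _ => (hint i).mul_const (taylorCoeff F i)

theorem eulerMaclaurinDefect_eq_of_eqOn_Ici {n : ℕ} {g : ℝ → ℂ} (hg : ContDiffAt ℝ n g X)
    (hgX : EqOn g 0 (Ici X)) :
    eulerMaclaurinDefect n X g = ∑ k ∈ Finset.Ioc 0 ⌊X⌋₊, g k - ∫ x in (0)..X, g x := by
  have hboundary : eulerMaclaurinBoundary n g X = 0 := Finset.sum_eq_zero fun j hj => by
    rw [iteratedDeriv_eq_zero_of_eqOn_Ici hg hgX self_mem_Ici (Finset.mem_range.1 hj).le,
      smul_zero, smul_zero]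
  rw [eulerMaclaurinDefect, hboundary, sub_zero]

theorem norm_cpowTail_mul_taylorCoeff_le {F : ℝ → ℂ} {A B : ℝ} (hX : 0 < X)
    (hB : ∀ x, |periodicBernoulli (m + 1) x| ≤ B) (hu : u.re ≤ 1 / 2)
    (hF : ContDiff ℝ (m + 1 : ℕ) F) (hFX : EqOn F 0 (Ici X))
    (hA : ∀ x ∈ Icc 0 X, ‖iteratedDeriv (m + 1) F x‖ ≤ A) {i : ℕ} (hi : i < m) :
    ‖cpowTail (m + 1) X (u + i) * taylorCoeff F i‖ ≤ 2 * B * (A * X ^ (1 + u.re)) := by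
  have him : (i : ℝ) + 1 ≤ m := by exact_mod_cast hi
  have hB0 : 0 ≤ B := (abs_nonneg _).trans (hB 0)
  have hre : (u + i).re = u.re + i := by simp
  have htail := norm_cpowTail_le hB (s := u + i) (by rw [hre]; push_cast; linarith) hX
  have hcoeff : ‖taylorCoeff F i‖ ≤ A * X ^ (m + 1 - i) := by
    have hjet := norm_iteratedDeriv_le_of_iteratedDeriv_eq_zero hF (c := X) (x := 0)
      (fun j hj => iteratedDeriv_eq_zero_of_eqOn_Ici hF.contDiffAt hFX self_mem_Ici hj.le)
      (fun y hy => hA y (by rwa [uIcc_of_ge hX.le] at hy)) (hi.le.trans m.le_succ)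
    rw [zero_sub, abs_neg, abs_of_pos hX] at hjet
    exact (norm_taylorCoeff_le F i).trans hjet
  have hdenom : (1 : ℝ) / 2 ≤ (m + 1 : ℕ) - 1 - (u.re + i) := by push_cast; linarith
  have hpow : X ^ (u.re + i - (m + 1 : ℕ) + 1) * X ^ (m + 1 - i) = X ^ (1 + u.re) := by
    rw [← Real.rpow_natCast X (m + 1 - i), ← Real.rpow_add hX,
      Nat.cast_sub (hi.le.trans m.le_succ)]
    congr 1
    ring
  rw [hre] at htail
  rw [norm_mul]
  calc _ ≤ B * (X ^ (u.re + i - (m + 1 : ℕ) + 1) / (1 / 2)) * (A * X ^ (m + 1 - i)) := by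
        gcongr
        refine htail.trans ?_
        gcongr
    _ = 2 * B * (A * (X ^ (u.re + i - (m + 1 : ℕ) + 1) * X ^ (m + 1 - i))) := by ring
    _ = _ := by rw [hpow]

/-- The constant in the error bound for sums of `x ^ u * F x`, where `B` bounds the periodic
Bernoulli function of order `m + 1`. -/
noncomputable def cpowSumErrorConst (m : ℕ) (B : ℝ) (u : ℂ) : ℝ :=
  B * cpowLeibnizConst (m + 1) u / (u.re + 1) +
    ∑ i ∈ Finset.range m, ‖(descPochhammer ℂ (m + 1)).eval (u + i)‖ * (2 * B)

theorem continuousOn_cpowSumErrorConst (m : ℕ) (B : ℝ) :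
    ContinuousOn (cpowSumErrorConst m B) {u | -1 < u.re} := by
  refine ContinuousOn.add (ContinuousOn.div ?_ (by fun_prop) fun u hu => ?_) ?_
  · exact (continuous_const.mul (continuous_cpowLeibnizConst (m + 1))).continuousOn
  · exact (neg_lt_iff_pos_add.1 hu).ne'
  · exact continuousOn_finsetSum _ fun i _ => (((descPochhammer ℂ (m + 1)).continuous.comp
      (continuous_add_const (i : ℂ))).norm.mul continuous_const).continuousOn

theorem sum_cpow_mul_sub_eq {F : ℝ → ℂ} (hX : 0 < X) (hu : -1 < u.re) (hu' : u.re ≤ 1 / 2)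
    (hF : ContDiff ℝ (m + 1 : ℕ) F) (hFX : EqOn F 0 (Ici X)) :
    (∑ n ∈ Finset.Ioc 0 ⌊X⌋₊, (n : ℂ) ^ u * F n) - (∫ x : ℝ in (0)..X, (x : ℂ) ^ u * F x) -
      ∑ i ∈ Finset.range m, riemannZeta (-(u + i)) * taylorCoeff F i =
      eulerMaclaurinDefect (m + 1) X (fun x : ℝ => (x : ℂ) ^ u * taylorRemainder m F x) -
        ∑ i ∈ Finset.range m, (-1) ^ m * ((descPochhammer ℂ (m + 1)).eval (u + i) *
          (cpowTail (m + 1) X (u + i) * taylorCoeff F i)) := by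
  have hzeta : ∀ i ∈ Finset.range m,
      eulerMaclaurinDefect (m + 1) X (fun x : ℝ => (x : ℂ) ^ (u + i)) * taylorCoeff F i =
        riemannZeta (-(u + i)) * taylorCoeff F i - (-1) ^ m *
          ((descPochhammer ℂ (m + 1)).eval (u + i) *
            (cpowTail (m + 1) X (u + i) * taylorCoeff F i)) := fun i hi => by
    have him : (i : ℝ) + 1 ≤ m := by exact_mod_cast Finset.mem_range.1 hi
    have hre : (u + i).re = u.re + i := by simp
    rw [eulerMaclaurinDefect_cpow (by linarith) (by linarith) hX]
    ring
  have hdefect := eulerMaclaurinDefect_eq_of_eqOn_Ici ((contDiffAt_ofReal_cpow u hX).mul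
    hF.contDiffAt) fun x hx => by simp [hFX hx]
  simp only [Complex.ofReal_natCast] at hdefect
  rw [← hdefect, eulerMaclaurinDefect_cpow_mul_eq (m := m) hu hX hF,
    Finset.sum_congr rfl hzeta, Finset.sum_sub_distrib]
  ring

theorem norm_sum_cpow_mul_sub_le {F : ℝ → ℂ} {A B : ℝ} (hX : 0 < X)
    (hB : ∀ x, |periodicBernoulli (m + 1) x| ≤ B) (hu : -1 < u.re) (hu' : u.re ≤ 1 / 2)
    (hF : ContDiff ℝ (m + 1 : ℕ) F) (hF0 : iteratedDeriv m F 0 = 0) (hFX : EqOn F 0 (Ici X))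
    (hA : ∀ x ∈ Icc 0 X, ‖iteratedDeriv (m + 1) F x‖ ≤ A) :
    ‖(∑ n ∈ Finset.Ioc 0 ⌊X⌋₊, (n : ℂ) ^ u * F n) - (∫ x : ℝ in (0)..X, (x : ℂ) ^ u * F x) -
      ∑ i ∈ Finset.range m, riemannZeta (-(u + i)) * taylorCoeff F i‖ ≤
      cpowSumErrorConst m B u * (A * X ^ (1 + u.re)) := by
  have hrzero : ∀ j ≤ m, iteratedDeriv j (taylorRemainder m F) 0 = 0 := fun j hj => by
    have hFj : ContDiff ℝ j F := hF.of_le (by exact_mod_cast hj.trans m.le_succ)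
    rcases hj.lt_or_eq with hjm | rfl
    · exact iteratedDeriv_taylorRemainder_zero hjm hFj
    · rw [iteratedDeriv_taylorRemainder_of_le le_rfl hFj, hF0]
  have hremainder := norm_eulerMaclaurinDefect_cpow_mul_le hX hB hu (contDiff_taylorRemainder hF m)
    hrzero fun x hx => by
      rw [iteratedDeriv_taylorRemainder_of_le m.le_succ hF]
      exact hA x hx
  rw [sum_cpow_mul_sub_eq hX hu hu' hF hFX, cpowSumErrorConst, add_mul, Finset.sum_mul]
  refine (norm_sub_le _ _).trans (add_le_add hremainder (norm_sum_le_of_le _ fun i hi => ?_))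
  rw [norm_mul, norm_mul, norm_pow, norm_neg, norm_one, one_pow, one_mul, mul_assoc]
  gcongr
  exact norm_cpowTail_mul_taylorCoeff_le hX hB hu' hF hFX hA (Finset.mem_range.1 hi)

theorem exists_norm_sum_cpow_mul_sub_le (m : ℕ) : ∃ C : ℝ, ∀ u : ℂ, ‖u‖ ≤ 1 / 2 →
    ∀ (F : ℝ → ℂ) (X A : ℝ), 0 < X → ContDiff ℝ (m + 1 : ℕ) F → iteratedDeriv m F 0 = 0 →
      EqOn F 0 (Ici X) → (∀ x ∈ Icc 0 X, ‖iteratedDeriv (m + 1) F x‖ ≤ A) →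
      ‖(∑ n ∈ Finset.Ioc 0 ⌊X⌋₊, (n : ℂ) ^ u * F n) - (∫ x : ℝ in (0)..X, (x : ℂ) ^ u * F x) -
        ∑ i ∈ Finset.range m, riemannZeta (-(u + i)) * taylorCoeff F i‖ ≤
        C * (A * X ^ (1 + u.re)) := by
  obtain ⟨B, -, hB⟩ := exists_abs_periodicBernoulli_le (m + 1)
  have hre : ∀ u ∈ Metric.closedBall (0 : ℂ) (1 / 2), -1 < u.re := fun u hu => by
    rw [mem_closedBall_zero_iff] at hu
    linarith [(abs_le.1 ((Complex.abs_re_le_norm u).trans hu)).1]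
  obtain ⟨C, hC⟩ := (isCompact_closedBall (0 : ℂ) (1 / 2)).exists_bound_of_continuousOn
    ((continuousOn_cpowSumErrorConst m B).mono hre)
  refine ⟨C, fun u hu F X A hX hF hF0 hFX hA => ?_⟩
  have hu' := mem_closedBall_zero_iff.2 hu
  have hA0 : 0 ≤ A := (norm_nonneg _).trans (hA 0 (left_mem_Icc.2 hX.le))
  refine (norm_sum_cpow_mul_sub_le hX hB (hre u hu')
    ((Complex.re_le_norm u).trans hu) hF hF0 hFX hA).trans ?_
  gcongr
  exact (le_abs_self _).trans (hC u hu')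

end Core

section Logarithm

variable {f : ℝ → ℂ} {a h : ℝ} {m : ℕ} {u : ℂ}

theorem mellin_add_one_eq_intervalIntegral (ha : 0 ≤ a) (hfa : EqOn f 0 (Ici a)) (u : ℂ) :
    mellin f (u + 1) = ∫ x : ℝ in (0)..a, (x : ℂ) ^ u * f x := by
  have hzero : ∀ x ∈ Ioi 0 \ Ioc 0 a, (x : ℂ) ^ u * f x = 0 := fun x hx => by
    rw [hfa (not_le.1 fun hxa => hx.2 ⟨hx.1, hxa⟩).le, Pi.zero_apply, mul_zero]
  rw [intervalIntegral.integral_of_le ha, ← setIntegral_eq_of_subset_of_forall_sdiff_eq_zero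
    measurableSet_Ioi Ioc_subset_Ioi_self hzero]
  simp only [mellin, add_sub_cancel_right, smul_eq_mul]

theorem hasDerivAt_mellin_add_one (hf : Continuous f) (hfa : EqOn f 0 (Ici a)) (hu : -1 < u.re) :
    HasDerivAt (fun u => mellin f (u + 1)) (mellin (fun x => Real.log x • f x) (u + 1)) u := by
  have htop : f =O[atTop] fun x : ℝ => x ^ (-((u + 1).re + 1)) :=
    (isBigO_zero _ _).congr' (((eventually_ge_atTop a).mono fun x hx => (hfa hx).symm)) .rfl
  have hbot : f =O[nhdsWithin 0 (Ioi 0)] fun x : ℝ => x ^ (-(0 : ℝ)) := by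
    simpa using (hf.tendsto 0).isBigO_one ℝ |>.mono nhdsWithin_le_nhds
  exact (mellin_hasDerivAt_of_isBigO_rpow (hf.locallyIntegrable.locallyIntegrableOn _) htop
    (lt_add_one _) hbot (by simpa using neg_lt_iff_pos_add.1 hu)).2.comp_add_const u 1

/-- The error of the rectangle rule on the positive grid points `h * n` for the integral of
`x ^ u * f x` over `[0, a]`, after the first `m` corrections at the endpoint `0`. -/
noncomputable def cpowQuadratureError (m : ℕ) (f : ℝ → ℂ) (a h : ℝ) (u : ℂ) : ℂ :=
  h * ∑ n ∈ Finset.Ioc 0 ⌊a / h⌋₊, ((h * n : ℝ) : ℂ) ^ u * f (h * n) - mellin f (u + 1) -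
    h * ∑ i ∈ Finset.range m, (h : ℂ) ^ (u + i) * riemannZeta (-(u + i)) * taylorCoeff f i

theorem taylorCoeff_comp_mul_left {i : ℕ} (hf : ContDiff ℝ i f) (h : ℝ) :
    taylorCoeff (fun x => f (h * x)) i = (h : ℂ) ^ i * taylorCoeff f i := by
  have hderiv := congrFun (iteratedDeriv_comp_const_smul hf h) 0
  rw [taylorCoeff, hderiv, mul_zero, smul_comm, Complex.real_smul, Complex.ofReal_pow, taylorCoeff]

theorem cpowQuadratureError_eq (hf : ContDiff ℝ m f) (hfa : EqOn f 0 (Ici a)) (ha : 0 < a)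
    (hh : 0 < h) :
    cpowQuadratureError m f a h u = (h : ℂ) ^ (u + 1) *
      ((∑ n ∈ Finset.Ioc 0 ⌊a / h⌋₊, (n : ℂ) ^ u * f (h * n)) -
        (∫ x : ℝ in (0)..a / h, (x : ℂ) ^ u * f (h * x)) -
        ∑ i ∈ Finset.range m, riemannZeta (-(u + i)) * taylorCoeff (fun x => f (h * x)) i) := by
  have hh0 : (h : ℂ) ≠ 0 := by exact_mod_cast hh.ne'
  have hpow : (h : ℂ) ^ (u + 1) = h * (h : ℂ) ^ u := by
    rw [Complex.cpow_add _ _ hh0, Complex.cpow_one, mul_comm]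
  have hmellin : (h : ℂ) ^ (u + 1) * (∫ x : ℝ in (0)..a / h, (x : ℂ) ^ u * f (h * x)) =
      mellin f (u + 1) := by
    rw [← mellin_add_one_eq_intervalIntegral (f := fun x => f (h * x)) (div_pos ha hh).le
      (fun x hx => hfa ((div_le_iff₀' hh).1 hx)), mellin_comp_mul_left f _ hh, smul_eq_mul,
      ← mul_assoc, ← Complex.cpow_add _ _ hh0, add_neg_cancel, Complex.cpow_zero, one_mul]
  have hsum : ∀ n : ℕ, h * (((h * n : ℝ) : ℂ) ^ u * f (h * n)) =
      (h : ℂ) ^ (u + 1) * ((n : ℂ) ^ u * f (h * n)) := fun n => by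
    rw [Complex.ofReal_mul, Complex.mul_cpow_ofReal_nonneg hh.le n.cast_nonneg,
      Complex.ofReal_natCast, hpow]
    ring
  have hcorrection : ∀ i ∈ Finset.range m,
      h * ((h : ℂ) ^ (u + i) * riemannZeta (-(u + i)) * taylorCoeff f i) =
        (h : ℂ) ^ (u + 1) *
          (riemannZeta (-(u + i)) * taylorCoeff (fun x => f (h * x)) i) := fun i hi => by
    rw [taylorCoeff_comp_mul_left (hf.of_le (by exact_mod_cast (Finset.mem_range.1 hi).le)),
      Complex.cpow_add _ _ hh0, Complex.cpow_natCast, hpow]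
    ring
  rw [cpowQuadratureError, Finset.mul_sum, Finset.sum_congr rfl fun n _ => hsum n, Finset.mul_sum,
    Finset.sum_congr rfl hcorrection, ← hmellin, ← Finset.mul_sum, ← Finset.mul_sum, mul_sub,
    mul_sub]

theorem exists_norm_cpowQuadratureError_le (hf : ContDiff ℝ (m + 1 : ℕ) f)
    (hf0 : iteratedDeriv m f 0 = 0) (ha : 0 < a) (hfa : EqOn f 0 (Ici a)) :
    ∃ C : ℝ, ∀ h, 0 < h → ∀ u : ℂ, ‖u‖ ≤ 1 / 2 →
      ‖cpowQuadratureError m f a h u‖ ≤ C * h ^ (m + 1) := by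
  obtain ⟨A, hA⟩ := (isCompact_Icc (a := (0 : ℝ)) (b := a)).exists_bound_of_continuousOn
    (hf.continuous_iteratedDeriv (m + 1) le_rfl).continuousOn
  obtain ⟨C, hC⟩ := exists_norm_sum_cpow_mul_sub_le m
  refine ⟨|C| * |A| * (1 + a) ^ (2 : ℝ), fun h hh u hu => ?_⟩
  have hmf : ContDiff ℝ m f := hf.of_le (by exact_mod_cast m.le_succ)
  have hcore := hC u hu (fun x => f (h * x)) (a / h) (h ^ (m + 1) * A) (div_pos ha hh)
    (hf.comp (contDiff_const.mul contDiff_id))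
    (by simp only [iteratedDeriv_comp_const_smul hmf, mul_zero, hf0, smul_zero])
    (fun x hx => hfa ((div_le_iff₀' hh).1 hx)) fun x hx => by
      rw [iteratedDeriv_comp_const_smul hf, norm_smul, Real.norm_of_nonneg (by positivity)]
      gcongr
      exact hA _ ⟨mul_nonneg hh.le hx.1, (le_div_iff₀' hh).1 hx.2⟩
  have hre := abs_le.1 ((Complex.abs_re_le_norm u).trans hu)
  have hscale : h ^ (u.re + 1) * (a / h) ^ (1 + u.re) = a ^ (1 + u.re) := by
    rw [add_comm u.re, ← Real.mul_rpow hh.le (div_pos ha hh).le, mul_div_cancel₀ _ hh.ne']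
  have hapow : a ^ (1 + u.re) ≤ (1 + a) ^ (2 : ℝ) :=
    (Real.rpow_le_rpow ha.le (by linarith) (by linarith)).trans
      (Real.rpow_le_rpow_of_exponent_le (by linarith) (by linarith))
  rw [cpowQuadratureError_eq hmf hfa ha hh, norm_mul, Complex.norm_cpow_eq_rpow_re_of_pos hh,
    Complex.add_re, Complex.one_re]
  calc _ ≤ h ^ (u.re + 1) * (C * (h ^ (m + 1) * A * (a / h) ^ (1 + u.re))) := by gcongr
    _ = C * A * (h ^ (u.re + 1) * (a / h) ^ (1 + u.re)) * h ^ (m + 1) := by ring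
    _ ≤ |C| * |A| * (1 + a) ^ (2 : ℝ) * h ^ (m + 1) := by
      rw [hscale, ← abs_mul]
      gcongr
      exact le_abs_self _

theorem hasDerivAt_ofReal_cpow_exponent {x : ℝ} (hx : 0 < x) (u : ℂ) :
    HasDerivAt (fun u : ℂ => (x : ℂ) ^ u) (Real.log x * (x : ℂ) ^ u) u := by
  simpa [Complex.ofReal_log hx.le, mul_comm] using
    (hasDerivAt_id u).const_cpow (Or.inl (Complex.ofReal_ne_zero.2 hx.ne'))

theorem hasDerivAt_cpow_mul_riemannZeta (hh : 0 < h) {s : ℂ} (hs : s ≠ -1) :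
    HasDerivAt (fun s : ℂ => (h : ℂ) ^ s * riemannZeta (-s))
      ((h : ℂ) ^ s * (Real.log h * riemannZeta (-s) - deriv riemannZeta (-s))) s := by
  have hzeta : DifferentiableAt ℂ riemannZeta (-s) :=
    differentiableAt_riemannZeta fun hs1 => hs (by rw [← hs1, neg_neg])
  refine ((hasDerivAt_ofReal_cpow_exponent hh s).mul
    (hzeta.hasDerivAt.scomp s (hasDerivAt_neg s))).congr_deriv ?_
  simp only [Function.comp_apply, smul_eq_mul]
  ring

theorem hasDerivAt_cpowQuadratureError (m : ℕ) (hf : Continuous f) (hfa : EqOn f 0 (Ici a))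
    (hh : 0 < h) (hu : -1 < u.re) :
    HasDerivAt (cpowQuadratureError m f a h)
      (h * ∑ n ∈ Finset.Ioc 0 ⌊a / h⌋₊,
          Real.log (h * n) * ((h * n : ℝ) : ℂ) ^ u * f (h * n) -
        mellin (fun x => Real.log x • f x) (u + 1) -
        h * ∑ i ∈ Finset.range m, (h : ℂ) ^ (u + i) * (Real.log h * riemannZeta (-(u + i)) -
          deriv riemannZeta (-(u + i))) * taylorCoeff f i) u := by
  refine ((HasDerivAt.fun_sum fun n hn => ?_).const_mul _ |>.sub
    (hasDerivAt_mellin_add_one hf hfa hu)).sub ((HasDerivAt.fun_sum fun i _ => ?_).const_mul _)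
  · have hn0 : (0 : ℝ) < n := by exact_mod_cast (Finset.mem_Ioc.1 hn).1
    exact (hasDerivAt_ofReal_cpow_exponent (mul_pos hh hn0) u).mul_const _
  · refine ((hasDerivAt_cpow_mul_riemannZeta hh fun hs => ?_).comp_add_const u (i : ℂ)).mul_const _
    have hre := congrArg Complex.re hs
    have := i.cast_nonneg (α := ℝ)
    simp only [Complex.add_re, Complex.natCast_re, Complex.neg_re, Complex.one_re] at hre
    linarith

theorem exists_norm_sum_log_sub_le (hf : ContDiff ℝ (m + 1 : ℕ) f)
    (hf0 : iteratedDeriv m f 0 = 0) (ha : 0 < a) (hfa : EqOn f 0 (Ici a)) :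
    ∃ C : ℝ, ∀ h, 0 < h →
      ‖h * (∑ n ∈ Finset.Ioc 0 ⌊a / h⌋₊, Real.log (h * n) * f (h * n)) -
        (∫ x in (0)..a, Real.log x * f x) -
        h * ∑ i ∈ Finset.range m, (h : ℂ) ^ i *
          (Real.log h * riemannZeta (-i) - deriv riemannZeta (-i)) * taylorCoeff f i‖ ≤
        C * h ^ (m + 1) := by
  obtain ⟨C, hC⟩ := exists_norm_cpowQuadratureError_le hf hf0 ha hfa
  refine ⟨C / (1 / 2), fun h hh => ?_⟩
  have hderiv := (hasDerivAt_cpowQuadratureError m hf.continuous hfa hh (u := 0) (by simp)).deriv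
  have hdiff : DiffContOnCl ℂ (cpowQuadratureError m f a h) (Metric.ball 0 (1 / 2)) := by
    refine DifferentiableOn.diffContOnCl_ball (U := Metric.ball 0 1) (fun u hu => ?_)
      (Metric.closedBall_subset_ball (by norm_num))
    refine (hasDerivAt_cpowQuadratureError m hf.continuous hfa hh
      ?_).differentiableAt.differentiableWithinAt
    exact (abs_lt.1 ((Complex.abs_re_le_norm u).trans_lt (mem_ball_zero_iff.1 hu))).1
  have hcauchy := Complex.norm_deriv_le_of_forall_mem_sphere_norm_le one_half_pos hdiff
    fun u hu => hC h hh u (mem_sphere_zero_iff_norm.1 hu).le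
  rw [hderiv, mellin_add_one_eq_intervalIntegral ha.le fun x hx => by simp [hfa hx]] at hcauchy
  simpa only [Complex.cpow_zero, mul_one, one_mul, zero_add, Complex.cpow_natCast,
    Complex.real_smul, div_mul_eq_mul_div] using hcauchy

end Logarithm

section Weights

open Matrix

theorem ofReal_re_deriv_riemannZeta (x : ℝ) :
    ((deriv riemannZeta x).re : ℂ) = deriv riemannZeta x := by
  have hconj : starRingEnd ℂ ∘ riemannZeta ∘ starRingEnd ℂ = riemannZeta := by
    ext s
    simp
  rw [← Complex.conj_eq_iff_re]
  conv_rhs => rw [← hconj, deriv_conj_conj]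
  simp

theorem isZetaPrimeWeights_iff_vecMul_vandermonde {K : ℕ} {w : Fin (K + 1) → ℝ} :
    IsZetaPrimeWeights K w ↔ w ᵥ* vandermonde (fun j => ((j : ℕ) : ℝ) ^ 2) =
      fun k : Fin (K + 1) => -(deriv riemannZeta (-(2 * ((k : ℕ) : ℂ)))).re := by
  have hreal (k : ℕ) : deriv riemannZeta (-(2 * (k : ℂ))) =
      ((deriv riemannZeta (-(2 * (k : ℂ)))).re : ℂ) := by
    simpa using (ofReal_re_deriv_riemannZeta (-(2 * k))).symm
  simp only [IsZetaPrimeWeights, funext_iff, Fin.forall_iff, Nat.lt_succ_iff, vecMul, dotProduct,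
    vandermonde_apply, ← pow_mul]
  refine forall₂_congr fun k _ => ?_
  rw [← Complex.ofReal_inj, Complex.ofReal_neg, ← hreal]

theorem isUnit_vandermonde_natCast_sq (n : ℕ) :
    IsUnit (vandermonde fun j : Fin n => ((j : ℕ) : ℝ) ^ 2) := by
  rw [isUnit_iff_isUnit_det, isUnit_iff_ne_zero, det_vandermonde_ne_zero_iff]
  intro i j hij
  rw [sq_eq_sq₀ (Nat.cast_nonneg _) (Nat.cast_nonneg _), Nat.cast_inj] at hij
  exact Fin.ext hij

theorem existsUnique_isZetaPrimeWeights (K : ℕ) :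
    ∃! w : Fin (K + 1) → ℝ, IsZetaPrimeWeights K w := by
  have hunit := isUnit_vandermonde_natCast_sq (K + 1)
  simp only [isZetaPrimeWeights_iff_vecMul_vandermonde]
  exact Function.Bijective.existsUnique
    ⟨vecMul_injective_iff_isUnit.2 hunit, vecMul_surjective_iff_isUnit.2 hunit⟩ _

theorem riemannZeta_neg_natCast_of_even {i : ℕ} (hi : Even i) :
    riemannZeta (-i) = if i = 0 then -1 / 2 else 0 := by
  obtain ⟨k, rfl⟩ := hi.exists_two_nsmul i
  rcases k with _ | k
  · simp [riemannZeta_zero]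
  · rw [if_neg (by simp), ← riemannZeta_neg_two_mul_nat_add_one k]
    congr 1
    push_cast [smul_eq_mul]
    ring

theorem IsZetaPrimeWeights.sum_mul_pow_eq {K : ℕ} {w : Fin (K + 1) → ℝ}
    (hw : IsZetaPrimeWeights K w) {i : ℕ} (hi : Even i) (hiK : i < 2 * K + 1) :
    ∑ j : Fin (K + 1), (w j : ℂ) * ((j : ℕ) : ℂ) ^ i = -deriv riemannZeta (-i) := by
  obtain ⟨k, rfl⟩ := hi.exists_two_nsmul i
  rw [smul_eq_mul] at hiK ⊢
  simpa using hw k (by lia)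

end Weights

section HalfLine

variable {K : ℕ} {w : Fin (K + 1) → ℝ} {a : ℝ}

/-- The error of the corrected right-endpoint rule with step `h` for `∫ x in 0..a, log x • f x`:
the correction removes the logarithmic singularity of an even `f` at the endpoint `0`. -/
noncomputable def halfLineError {E : Type*} [NormedAddCommGroup E] [NormedSpace ℝ E]
    (w : Fin (K + 1) → ℝ) (a : ℝ) (f : ℝ → E) (h : ℝ) : E :=
  h • (∑ n ∈ Finset.Ioc 0 ⌊a / h⌋₊, Real.log (h * n) • f (h * n)) -
    (∫ x in (0)..a, Real.log x • f x) + (h * Real.log h / 2) • f 0 -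
    h • ∑ j : Fin (K + 1), w j • f ((j : ℕ) * h)

theorem IsZetaPrimeWeights.sum_smul_pow_smul_eq (hw : IsZetaPrimeWeights K w) {i : ℕ}
    (hi : Even i) (hiK : i < 2 * K + 1) (h : ℝ) (c : ℂ) :
    ∑ j : Fin (K + 1), w j • ((j : ℕ) * h) ^ i • c =
      (h : ℂ) ^ i * (Real.log h * riemannZeta (-i) - deriv riemannZeta (-i)) * c +
        if i = 0 then (Real.log h / 2) • c else 0 := by
  rw [riemannZeta_neg_natCast_of_even hi, sub_eq_add_neg, ← hw.sum_mul_pow_eq hi hiK]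
  have hsum : ∑ j : Fin (K + 1), w j • ((j : ℕ) * h) ^ i • c =
      (h : ℂ) ^ i * (∑ j : Fin (K + 1), (w j : ℂ) * ((j : ℕ) : ℂ) ^ i) * c := by
    simp only [Finset.mul_sum, Finset.sum_mul, Complex.real_smul]
    push_cast
    exact Finset.sum_congr rfl fun j _ => by ring
  rw [hsum]
  split_ifs with hi0
  · rw [hi0, Complex.real_smul]
    push_cast
    ring
  · ring

/-- The `log h` contributions survive only for `i = 0`, since `ζ` vanishes at the negative even
integers; the terms with odd `i` vanish by parity. -/
theorem IsZetaPrimeWeights.sum_zeta_mul_taylorCoeff_eq (hw : IsZetaPrimeWeights K w) {f : ℝ → ℂ}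
    (hf : Function.Even f) (h : ℝ) :
    ∑ i ∈ Finset.range (2 * K + 1), (h : ℂ) ^ i *
        (Real.log h * riemannZeta (-i) - deriv riemannZeta (-i)) * taylorCoeff f i =
      ∑ j : Fin (K + 1), w j •
        (f ((j : ℕ) * h) - taylorRemainder (2 * K + 1) f ((j : ℕ) * h)) -
      (Real.log h / 2) • f 0 := by
  have hzero : (Real.log h / 2) • f 0 = ∑ i ∈ Finset.range (2 * K + 1),
      if i = 0 then (Real.log h / 2) • taylorCoeff f i else 0 := by
    simp [taylorCoeff]
  simp only [taylorRemainder, sub_sub_cancel, Finset.smul_sum]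
  rw [Finset.sum_comm, hzero, ← Finset.sum_sub_distrib]
  refine Finset.sum_congr rfl fun i hi => ?_
  rcases i.even_or_odd with heven | hodd
  · rw [hw.sum_smul_pow_smul_eq heven (Finset.mem_range.1 hi), add_sub_cancel_right]
  · have hcoeff : taylorCoeff f i = 0 := by
      rw [taylorCoeff, iteratedDeriv_eq_zero_of_even hf hodd, smul_zero]
    simp [hcoeff]

theorem isBigO_taylorRemainder_of_even {E : Type*} [NormedAddCommGroup E] [NormedSpace ℝ E]
    {f : ℝ → E} (hf : ContDiff ℝ (2 * K + 2 : ℕ) f) (heven : Function.Even f) :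
    taylorRemainder (2 * K + 1) f =O[nhds 0] fun x => x ^ (2 * K + 2) := by
  refine isBigO_pow_of_iteratedDeriv_eq_zero (contDiff_taylorRemainder hf _) fun i hi => ?_
  have hfi : ContDiff ℝ i f := hf.of_le (by exact_mod_cast hi.le)
  rcases (Nat.lt_succ_iff.1 hi).lt_or_eq with hlt | rfl
  · exact iteratedDeriv_taylorRemainder_zero hlt hfi
  · rw [iteratedDeriv_taylorRemainder_of_le le_rfl hfi]
    exact iteratedDeriv_eq_zero_of_even heven (odd_two_mul_add_one K)

theorem isBigO_smul_sum_smul_comp_mul {E : Type*} [NormedAddCommGroup E] [NormedSpace ℝ E]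
    {g : ℝ → E} {n : ℕ} (hg : g =O[nhds 0] fun x => x ^ n) (w : Fin (K + 1) → ℝ) :
    (fun h : ℝ => h • ∑ j : Fin (K + 1), w j • g ((j : ℕ) * h)) =O[nhds 0] fun h => h ^ n := by
  have hterm (j : ℕ) : (fun h : ℝ => g (j * h)) =O[nhds 0] fun h => h ^ n := by
    have htendsto : Tendsto (fun h : ℝ => j * h) (nhds 0) (nhds 0) := by
      simpa using (continuous_const_mul (j : ℝ)).tendsto 0
    refine (hg.comp_tendsto htendsto).trans ?_
    simpa only [Function.comp_def, mul_pow] using isBigO_const_mul_self _ _ _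
  have hid : (fun h : ℝ => h) =O[nhds 0] fun _ => (1 : ℝ) :=
    (continuous_id.tendsto (0 : ℝ)).isBigO_one ℝ
  have hsum : (fun h : ℝ => ∑ j : Fin (K + 1), w j • g ((j : ℕ) * h)) =O[nhds 0] fun h => h ^ n :=
    IsBigO.fun_sum fun j _ => (hterm j).const_smul_left (w j)
  simpa using hid.smul hsum

theorem isBigO_halfLineError_complex (hw : IsZetaPrimeWeights K w) (ha : 0 < a) {f : ℝ → ℂ}
    (hf : ContDiff ℝ (2 * K + 2 : ℕ) f) (heven : Function.Even f) (hfa : EqOn f 0 (Ici a)) :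
    halfLineError w a f =O[nhdsWithin 0 (Ioi 0)] fun h => h ^ (2 * K + 2) := by
  obtain ⟨C, hC⟩ := exists_norm_sum_log_sub_le hf
    (iteratedDeriv_eq_zero_of_even heven (odd_two_mul_add_one K)) ha hfa
  have hremainder := (isBigO_smul_sum_smul_comp_mul (isBigO_taylorRemainder_of_even hf heven)
    w).mono (nhdsWithin_le_nhds (s := Ioi 0))
  have hsum : (fun h => halfLineError w a f h +
      h • ∑ j : Fin (K + 1), w j • taylorRemainder (2 * K + 1) f ((j : ℕ) * h))
      =O[nhdsWithin 0 (Ioi 0)] fun h => h ^ (2 * K + 2) := by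
    refine IsBigO.of_bound C ?_
    filter_upwards [self_mem_nhdsWithin] with h hh
    rw [norm_pow, Real.norm_of_nonneg (le_of_lt hh)]
    convert hC h hh using 2
    rw [hw.sum_zeta_mul_taylorCoeff_eq heven]
    simp only [halfLineError, Complex.real_smul, smul_sub, Finset.sum_sub_distrib]
    push_cast
    ring
  simpa only [add_sub_cancel_right] using hsum.sub hremainder

variable {E : Type*} [NormedAddCommGroup E] [NormedSpace ℝ E]

theorem map_halfLineError {F : Type*} [NormedAddCommGroup F] [NormedSpace ℝ F] [CompleteSpace E]
    [CompleteSpace F] (L : E →L[ℝ] F) (w : Fin (K + 1) → ℝ) (a : ℝ) {f : ℝ → E}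
    (hf : Continuous f) (h : ℝ) :
    L (halfLineError w a f h) = halfLineError w a (L ∘ f) h := by
  have hint : IntervalIntegrable (fun x => Real.log x • f x) volume 0 a :=
    intervalIntegral.intervalIntegrable_log'.smul_continuousOn hf.continuousOn
  simp only [halfLineError, map_sub, map_add, map_smul, map_sum, Function.comp_apply]
  rw [← L.intervalIntegral_comp_comm hint]
  simp only [map_smul]

theorem isBigO_halfLineError [FiniteDimensional ℝ E] (hw : IsZetaPrimeWeights K w) (ha : 0 < a)
    {f : ℝ → E} (hf : ContDiff ℝ (2 * K + 2 : ℕ) f) (heven : Function.Even f)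
    (hfa : EqOn f 0 (Ici a)) :
    halfLineError w a f =O[nhdsWithin 0 (Ioi 0)] fun h => h ^ (2 * K + 2) := by
  have : CompleteSpace E := FiniteDimensional.complete ℝ E
  let e := ContinuousLinearEquiv.ofFinrankEq (𝕜 := ℝ) (E := E)
    (F := Fin (Module.finrank ℝ E) → ℝ) (by simp)
  refine (e.isBigO_comp_rev _ _).trans (isBigO_pi.2 fun i => ?_)
  let L : E →L[ℝ] ℂ := Complex.ofRealCLM ∘L ContinuousLinearMap.proj i ∘L e.toContinuousLinearMap
  have hcomp : halfLineError w a (L ∘ f) =O[nhdsWithin 0 (Ioi 0)] fun h => h ^ (2 * K + 2) :=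
    isBigO_halfLineError_complex hw ha (L.contDiff.comp hf)
      (fun x => congrArg L (heven x)) fun x hx => by simp [hfa hx]
  refine (hcomp.norm_left.congr_left fun h => ?_).of_norm_left
  rw [← map_halfLineError L w a hf.continuous]
  exact Complex.norm_real _

end HalfLine

section Cutoff

variable {E : Type*} [NormedAddCommGroup E] [NormedSpace ℝ E] {c d : ℝ} {η : ℝ → ℝ} {τ : ℝ → E}

theorem eq_zero_of_tsupport_subset_Icc {F : Type*} [TopologicalSpace F] [T1Space F] [Zero F]
    {g : ℝ → F} (hg : Continuous g) (hs : tsupport g ⊆ Icc c d) {x : ℝ} (hx : x ∉ Ioo c d) :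
    g x = 0 := by
  by_contra hne
  have hint := hg.isOpen_support.subset_interior_iff.2 ((subset_tsupport g).trans hs)
  rw [interior_Icc] at hint
  exact hx (hint hne)

theorem isBigO_smul_of_tsupport_subset (hs : tsupport η ⊆ Icc c d)
    (hτ : ContinuousOn τ (Icc c d)) : (fun x => η x • τ x) =O[⊤] η := by
  obtain ⟨B, hB⟩ := isCompact_Icc.exists_bound_of_continuousOn hτ
  refine IsBigO.of_bound B (Eventually.of_forall fun x => ?_)
  rw [norm_smul, mul_comm]
  by_cases hx : x ∈ Icc c d
  · exact mul_le_mul_of_nonneg_right (hB x hx) (norm_nonneg _)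
  · simp [image_eq_zero_of_notMem_tsupport fun h => hx (hs h)]

theorem continuous_smul_of_tsupport_subset (hη : Continuous η) (hs : tsupport η ⊆ Icc c d)
    (hτ : ContinuousOn τ (Icc c d)) : Continuous fun x => η x • τ x := by
  refine continuous_iff_continuousAt.2 fun x => ?_
  by_cases hx : x ∈ Ioo c d
  · exact hη.continuousAt.smul (hτ.continuousAt (Icc_mem_nhds hx.1 hx.2))
  · have hηx := eq_zero_of_tsupport_subset_Icc hη hs hx
    have hlim : Tendsto η (nhds x) (nhds 0) := by simpa only [hηx] using hη.tendsto x
    rw [ContinuousAt, hηx, zero_smul]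
    exact ((isBigO_smul_of_tsupport_subset hs hτ).mono le_top).trans_tendsto hlim

/-- At the endpoints, where `τ` need not be differentiable, both `η` and its derivative vanish. -/
theorem hasDerivAt_smul_of_tsupport_subset (hη : ContDiff ℝ 1 η) (hs : tsupport η ⊆ Icc c d)
    (hτ : DifferentiableOn ℝ τ (Icc c d)) (x : ℝ) :
    HasDerivAt (fun x => η x • τ x)
      (η x • derivWithin τ (Icc c d) x + deriv η x • τ x) x := by
  have hderiv : HasDerivAt η (deriv η x) x := (hη.differentiable one_ne_zero x).hasDerivAt
  by_cases hx : x ∈ Ioo c d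
  · exact hderiv.smul ((hτ x (Ioo_subset_Icc_self hx)).hasDerivWithinAt.hasDerivAt
      (Icc_mem_nhds hx.1 hx.2))
  · have hηx : η x = 0 := eq_zero_of_tsupport_subset_Icc hη.continuous hs hx
    have hη'x : deriv η x = 0 := eq_zero_of_tsupport_subset_Icc (hη.continuous_deriv le_rfl)
      ((tsupport_deriv_subset (f := η)).trans hs) hx
    rw [hη'x, hasDerivAt_iff_isLittleO] at hderiv
    rw [hηx, hη'x, zero_smul, zero_smul, add_zero, hasDerivAt_iff_isLittleO]
    simp only [hηx, smul_zero, sub_zero, zero_smul] at hderiv ⊢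
    exact ((isBigO_smul_of_tsupport_subset hs hτ.continuousOn).mono le_top).trans_isLittleO hderiv

theorem contDiff_smul_of_tsupport_subset (hcd : c < d) {n : ℕ} (hη : ContDiff ℝ n η)
    (hs : tsupport η ⊆ Icc c d) (hτ : ContDiffOn ℝ n τ (Icc c d)) :
    ContDiff ℝ n fun x => η x • τ x := by
  induction n generalizing η τ with
  | zero =>
    rw [Nat.cast_zero, contDiff_zero] at hη ⊢
    exact continuous_smul_of_tsupport_subset hη hs hτ.continuousOn
  | succ n ih =>
    have hn : (n : WithTop ℕ∞) ≤ (n + 1 : ℕ) := by exact_mod_cast n.le_succ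
    have hone : (1 : WithTop ℕ∞) ≤ (n + 1 : ℕ) := by exact_mod_cast Nat.le_add_left 1 n
    have hη' : ContDiff ℝ n (deriv η) := (contDiff_succ_iff_deriv.1 (by exact_mod_cast hη)).2.2
    have hτ' : ContDiffOn ℝ n (derivWithin τ (Icc c d)) (Icc c d) :=
      hτ.derivWithin (uniqueDiffOn_Icc hcd) (by push_cast; exact le_rfl)
    have hderiv := hasDerivAt_smul_of_tsupport_subset (hη.of_le hone) hs
      (hτ.differentiableOn (by simp))
    push_cast
    refine contDiff_succ_iff_deriv.2 ⟨fun x => (hderiv x).differentiableAt, by simp, ?_⟩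
    rw [funext fun x => (hderiv x).deriv]
    exact (ih (hη.of_le hn) hs hτ').add
      (ih hη' ((tsupport_deriv_subset (f := η)).trans hs) (hτ.of_le hn))

theorem IsCutoff.sub_one_isBigO {a : ℝ} {p m : ℕ} (hη : IsCutoff a p m η) (hmp : m < p) :
    (fun x => η x - 1) =O[nhds 0] fun x => x ^ (m + 1) := by
  have hcontDiff : ContDiff ℝ (m + 1 : ℕ) η := hη.contDiff.of_le (by exact_mod_cast hmp)
  refine isBigO_pow_of_iteratedDeriv_eq_zero (hcontDiff.sub contDiff_const) fun i hi => ?_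
  rcases i with _ | i
  · simp [hη.map_zero]
  · rw [iteratedDeriv_succ', funext fun x => deriv_sub_const (f := η) (x := x) 1,
      ← iteratedDeriv_succ']
    exact hη.iteratedDeriv_zero (i + 1) (by lia) (by lia)

end Cutoff

section Symmetrization

/-- Twice the even part of `F`; it reduces the two-sided quadrature problem to the half-line. -/
def symmetrization {A : Type*} [Add A] (F : ℝ → A) (x : ℝ) : A :=
  F x + F (-x)

theorem even_symmetrization {A : Type*} [AddCommMagma A] (F : ℝ → A) :
    Function.Even (symmetrization F) := fun x => by
  rw [symmetrization, symmetrization, neg_neg, add_comm]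

theorem isBigO_symmetrization {E : Type*} [SeminormedAddCommGroup E] {F : ℝ → E} {n : ℕ}
    (hF : F =O[nhds 0] fun x => x ^ n) :
    symmetrization F =O[nhds 0] fun x => x ^ n := by
  have hneg : Tendsto (fun x : ℝ => -x) (nhds 0) (nhds 0) := by
    simpa using (continuous_neg (G := ℝ)).tendsto 0
  refine hF.add ((hF.comp_tendsto hneg).trans (isBigO_of_le _ fun x => ?_))
  simp

variable {E : Type*} [NormedAddCommGroup E] [NormedSpace ℝ E] {F : ℝ → E}

theorem contDiff_symmetrization {n : WithTop ℕ∞} (hF : ContDiff ℝ n F) :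
    ContDiff ℝ n (symmetrization F) :=
  hF.add (hF.comp contDiff_neg)

theorem integral_eq_integral_symmetrization {a : ℝ} (hF : IntervalIntegrable F volume (-a) a) :
    ∫ x in (-a)..a, F x = ∫ x in (0)..a, symmetrization F x := by
  have hmem : (0 : ℝ) ∈ uIcc (-a) a := by simp [mem_uIcc, le_total]
  have hleft : IntervalIntegrable F volume (-a) 0 :=
    hF.mono_set (uIcc_subset_uIcc left_mem_uIcc hmem)
  have hright : IntervalIntegrable F volume 0 a :=
    hF.mono_set (uIcc_subset_uIcc hmem right_mem_uIcc)
  have hneg : IntervalIntegrable (fun x => F (-x)) volume 0 a := by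
    simpa using ((IntervalIntegrable.iff_comp_neg).1 hleft).symm
  simp only [symmetrization]
  rw [intervalIntegral.integral_add hright hneg, intervalIntegral.integral_comp_neg, neg_zero,
    add_comm, intervalIntegral.integral_add_adjacent_intervals hleft hright]

theorem sum_Icc_neg_erase_zero {A : Type*} [AddCommMonoid A] (M : ℕ) (g : ℤ → A) :
    ∑ n ∈ (Finset.Icc (-(M : ℤ)) M).erase 0, g n = ∑ n ∈ Finset.Ioc 0 M, (g n + g (-n)) := by
  induction M with
  | zero => simp
  | succ M ih =>
    have hinsert : (Finset.Icc (-((M + 1 : ℕ) : ℤ)) (M + 1 : ℕ)).erase 0 =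
        insert ((M + 1 : ℕ) : ℤ) (insert (-((M + 1 : ℕ) : ℤ))
          ((Finset.Icc (-(M : ℤ)) M).erase 0)) := by
      ext n
      simp only [Finset.mem_erase, Finset.mem_Icc, Finset.mem_insert]
      lia
    rw [hinsert, Finset.sum_insert (by simp; lia), Finset.sum_insert (by simp), ih,
      Finset.sum_Ioc_succ_top M.zero_le, ← add_assoc, add_comm]

theorem intervalIntegrable_negLogAbs_smul (hF : Continuous F) (b c : ℝ) :
    IntervalIntegrable (fun x => negLogAbs x • F x) volume b c := by
  have hlog : IntervalIntegrable negLogAbs volume b c := by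
    unfold negLogAbs
    simp only [Real.log_abs]
    exact intervalIntegral.intervalIntegrable_log'.neg
  exact hlog.smul_continuousOn hF.continuousOn

theorem symmetrization_negLogAbs_smul (F : ℝ → E) (x : ℝ) :
    symmetrization (fun x => negLogAbs x • F x) x = -(Real.log x • symmetrization F x) := by
  simp only [symmetrization, negLogAbs, abs_neg, Real.log_abs]
  module

end Symmetrization

section Assembly

variable {𝕜 : Type*} [RCLike 𝕜] {F : ℝ → 𝕜} {a : ℝ}

theorem I_negLogAbs_smul (hF : Continuous F) (a : ℝ) :
    I a (fun x => negLogAbs x • F x) = -∫ x in (0)..a, Real.log x • symmetrization F x := by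
  rw [I, integral_eq_integral_symmetrization (intervalIntegrable_negLogAbs_smul hF _ _)]
  simp only [symmetrization_negLogAbs_smul, intervalIntegral.integral_neg]

theorem puncturedTrapezoidal_negLogAbs_smul (a : ℝ) (M : ℕ) (F : ℝ → 𝕜) :
    puncturedTrapezoidal a M (fun x => negLogAbs x • F x) =
      -(spacing a M • ∑ n ∈ Finset.Ioc 0 M,
        Real.log (spacing a M * n) • symmetrization F (spacing a M * n)) := by
  rw [puncturedTrapezoidal, sum_Icc_neg_erase_zero, ← smul_neg, ← Finset.sum_neg_distrib,
    Finset.smul_sum]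
  refine Finset.sum_congr rfl fun n _ => ?_
  rw [← symmetrization_negLogAbs_smul, symmetrization, ← add_mul, mul_comm,
    ← RCLike.real_smul_eq_coe_mul]
  simp only [Int.cast_neg, Int.cast_natCast, neg_mul, mul_comm (n : ℝ)]

theorem spacing_pos (ha : 0 < a) (M : ℕ) : 0 < spacing a M :=
  div_pos ha (by positivity)

theorem floor_div_spacing (ha : a ≠ 0) (M : ℕ) : ⌊a / spacing a M⌋₊ = M := by
  rw [spacing, div_div_cancel₀ ha, Nat.floor_eq_iff (by positivity)]
  constructor <;> linarith

theorem tendsto_spacing (ha : 0 < a) : Tendsto (spacing a) atTop (nhdsWithin 0 (Ioi 0)) := by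
  refine tendsto_nhdsWithin_iff.2 ⟨?_, Eventually.of_forall (spacing_pos ha)⟩
  exact (tendsto_natCast_atTop_atTop.atTop_add tendsto_const_nhds).const_div_atTop a

theorem I_sub_correctedTrapezoidal_eq {K M : ℕ} (w : Fin (K + 1) → ℝ) (ha : a ≠ 0)
    (hF : Continuous F) (τ : ℝ → 𝕜) (hFτ : F 0 = τ 0) :
    I a (fun x => negLogAbs x • F x) -
        (puncturedTrapezoidal a M (fun x => negLogAbs x • F x) -
          (spacing a M * Real.log (spacing a M)) • τ 0 +
          spacing a M • ∑ j : Fin (K + 1), w j • symmetrization τ ((j : ℕ) * spacing a M)) =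
      halfLineError w a (symmetrization F) (spacing a M) + spacing a M • ∑ j : Fin (K + 1),
        w j • symmetrization (fun x => F x - τ x) ((j : ℕ) * spacing a M) := by
  have hsub (x : ℝ) : symmetrization (fun x => F x - τ x) x =
      symmetrization F x - symmetrization τ x := add_sub_add_comm _ _ _ _ |>.symm
  have hzero : symmetrization F 0 = (2 : ℝ) • τ 0 := by
    rw [symmetrization, neg_zero, hFτ, two_smul]
  rw [I_negLogAbs_smul hF, puncturedTrapezoidal_negLogAbs_smul, halfLineError,
    floor_div_spacing ha, hzero]
  simp only [hsub, smul_sub, Finset.sum_sub_distrib]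
  module

theorem IsCutoff.smul_sub_isBigO {p m : ℕ} {η : ℝ → ℝ} {τ : ℝ → 𝕜} (hη : IsCutoff a p m η)
    (hmp : m < p) (hτ : ContinuousAt τ 0) :
    (fun x => η x • τ x - τ x) =O[nhds 0] fun x => x ^ (m + 1) := by
  simpa [sub_smul] using (hη.sub_one_isBigO hmp).smul (hτ.isBigO_one ℝ)

theorem correctedTrapezoidal_isBigO {K p : ℕ} {w : Fin (K + 1) → ℝ} {η : ℝ → ℝ} {τ : ℝ → 𝕜}
    (hw : IsZetaPrimeWeights K w) (ha : 0 < a) (hp : 2 * K + 1 < p)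
    (hη : IsCutoff a p (2 * K + 1) η) (hτ : ContDiffOn ℝ (2 * K + 2 : ℕ) τ (Icc (-a) a)) :
    (fun M : ℕ => I a (fun x => negLogAbs x • η x • τ x) -
      (puncturedTrapezoidal a M (fun x => negLogAbs x • η x • τ x) -
        (spacing a M * Real.log (spacing a M)) • τ 0 +
        spacing a M • ∑ j : Fin (K + 1), w j • symmetrization τ ((j : ℕ) * spacing a M)))
      =O[atTop] fun M => spacing a M ^ (2 * K + 2) := by
  have hF : ContDiff ℝ (2 * K + 2 : ℕ) fun x => η x • τ x :=
    contDiff_smul_of_tsupport_subset (neg_lt_self ha)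
      (hη.contDiff.of_le (by exact_mod_cast hp)) hη.tsupport_subset hτ
  have hFa : EqOn (symmetrization fun x => η x • τ x) 0 (Ici a) := fun x hx => by
    have hη0 {y : ℝ} (hy : y ∉ Ioo (-a) a) : η y = 0 :=
      eq_zero_of_tsupport_subset_Icc hη.contDiff.continuous hη.tsupport_subset hy
    simp [symmetrization, hη0 fun h => h.2.not_ge hx, hη0 fun h => (neg_lt_neg_iff.1 h.1).not_ge hx]
  have hτ0 : ContinuousAt τ 0 := hτ.continuousOn.continuousAt (Icc_mem_nhds (neg_lt_zero.2 ha) ha)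
  have hcutoff := (isBigO_smul_sum_smul_comp_mul
    (isBigO_symmetrization (hη.smul_sub_isBigO hp hτ0)) w).mono (nhdsWithin_le_nhds (s := Ioi 0))
  have hhalf := isBigO_halfLineError hw ha (contDiff_symmetrization hF) (even_symmetrization _) hFa
  refine ((hhalf.add hcutoff).comp_tendsto (tendsto_spacing ha)).congr_left fun M => ?_
  exact (I_sub_correctedTrapezoidal_eq w ha.ne' hF.continuous τ (by simp [hη.map_zero])).symm

end Assembly

end CorrectedTrapezoidal

theorem mainTheorem2_general (K : ℕ) :
    (∃! w : Fin (K + 1) → ℝ, CorrectedTrapezoidal.IsZetaPrimeWeights K w) ∧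
    ∀ w : Fin (K + 1) → ℝ, CorrectedTrapezoidal.IsZetaPrimeWeights K w →
      ∀ {𝕜 : Type*} [RCLike 𝕜] (a : ℝ) (p : ℕ) (η : ℝ → ℝ) (τ : ℝ → 𝕜),
        0 < a → 2 * K + 1 < p →
        CorrectedTrapezoidal.IsCutoff a p (2 * K + 1) η →
        ContDiffOn ℝ (2 * K + 2 : ℕ) τ (Icc (-a) a) →
        IntervalIntegrable
          (fun x : ℝ => (CorrectedTrapezoidal.negLogAbs x : 𝕜) * τ x * (η x : 𝕜))
          volume (-a) a ∧
        (fun M : ℕ =>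
          CorrectedTrapezoidal.I a
              (fun x : ℝ => (CorrectedTrapezoidal.negLogAbs x : 𝕜) * τ x * (η x : 𝕜)) -
            (CorrectedTrapezoidal.puncturedTrapezoidal a M
                (fun x : ℝ => (CorrectedTrapezoidal.negLogAbs x : 𝕜) * τ x * (η x : 𝕜)) -
              τ 0 * ((CorrectedTrapezoidal.spacing a M *
                Real.log (CorrectedTrapezoidal.spacing a M) : ℝ) : 𝕜) +
              (CorrectedTrapezoidal.spacing a M : 𝕜) *
                ∑ j : Fin (K + 1), (w j : 𝕜) *
                  (τ (((j : ℕ) : ℝ) * CorrectedTrapezoidal.spacing a M) +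
                    τ (-(((j : ℕ) : ℝ) * CorrectedTrapezoidal.spacing a M)))))
          =O[atTop] (fun M : ℕ => CorrectedTrapezoidal.spacing a M ^ (2 * K + 2)) := by
  refine ⟨CorrectedTrapezoidal.existsUnique_isZetaPrimeWeights K,
    fun w hw 𝕜 _ a p η τ ha hp hη hτ => ?_⟩
  have hintegrand : (fun x : ℝ => (CorrectedTrapezoidal.negLogAbs x : 𝕜) * τ x * (η x : 𝕜)) =
      fun x => CorrectedTrapezoidal.negLogAbs x • η x • τ x := by
    ext x
    simp only [RCLike.real_smul_eq_coe_mul]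
    ring
  rw [hintegrand]
  constructor
  · exact CorrectedTrapezoidal.intervalIntegrable_negLogAbs_smul
      (CorrectedTrapezoidal.continuous_smul_of_tsupport_subset hη.contDiff.continuous
        hη.tsupport_subset hτ.continuousOn) _ _
  · simpa only [RCLike.real_smul_eq_coe_mul, mul_comm (τ 0),
      CorrectedTrapezoidal.symmetrization] using
      CorrectedTrapezoidal.correctedTrapezoidal_isBigO hw ha hp hη hτ

theorem mainTheorem2 (K : ℕ) :
    (∃! w : Fin (K + 1) → ℝ, CorrectedTrapezoidal.IsZetaPrimeWeights K w) ∧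
    ∀ w : Fin (K + 1) → ℝ, CorrectedTrapezoidal.IsZetaPrimeWeights K w →
      ∀ {𝕜 : Type*} [RCLike 𝕜] (a : ℝ) (p : ℕ) (η : ℝ → ℝ) (τ : ℝ → 𝕜),
        0 < a → 2 * K + 1 < p →
        CorrectedTrapezoidal.IsCutoff a p (2 * K + 1) η →
        ContDiffOn ℝ ∞ τ (Icc (-a) a) →
        IntervalIntegrable
          (fun x : ℝ => (CorrectedTrapezoidal.negLogAbs x : 𝕜) * τ x * (η x : 𝕜))
          volume (-a) a ∧
        (fun M : ℕ =>
          CorrectedTrapezoidal.I a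
              (fun x : ℝ => (CorrectedTrapezoidal.negLogAbs x : 𝕜) * τ x * (η x : 𝕜)) -
            (CorrectedTrapezoidal.puncturedTrapezoidal a M
                (fun x : ℝ => (CorrectedTrapezoidal.negLogAbs x : 𝕜) * τ x * (η x : 𝕜)) -
              τ 0 * ((CorrectedTrapezoidal.spacing a M *
                Real.log (CorrectedTrapezoidal.spacing a M) : ℝ) : 𝕜) +
              (CorrectedTrapezoidal.spacing a M : 𝕜) *
                ∑ j : Fin (K + 1), (w j : 𝕜) *
                  (τ (((j : ℕ) : ℝ) * CorrectedTrapezoidal.spacing a M) +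
                    τ (-(((j : ℕ) : ℝ) * CorrectedTrapezoidal.spacing a M)))))
          =O[atTop] (fun M : ℕ => CorrectedTrapezoidal.spacing a M ^ (2 * K + 2)) := by
  exact (mainTheorem2_general K).imp_right fun hrule w hw _ _ a p η τ ha hp hη hτ =>
    hrule w hw a p η τ ha hp hη (contDiffOn_infty.1 hτ _)
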